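/- **Parallel offering with identical positions.** An instance $I=(k,T,n,p,v)$ has $1\le k\le T\le n$, $k$ identical positions, $T$ offering rounds and $n$ candidates; candidate $i$ has value $v_i\ge 0$ and accepts an offer for position $j$ with probability $p_i\in[0,1]$ (write $v_{ij}=v_i$, $p_{ij}=p_i$ for $j\in[k]$). In each round the firm can send one offer for each position that is still unfilled; each candidate receives at most one offer in total, and an accepted offer fills the position and yields the candidate's value. Candidates decide in advance which positions they would accept; these decisions are independent across candidates but may be arbitrarily correlated across positions for a single candidate. Let $$\mathrm{LP}_{\mathrm{par}}(I)=\max\Big\{\sum_{j,i} v_{ij}y_{ij}p_{ij}\;:\;\sum_i y_{ij}\le T\ \forall j,\ \ \sum_i y_{ij}p_{ij}\le 1\ \forall j,\ \ \sum_j y_{ij}\le 1\ \forall i,\ \ 0\le y_{ij}\le 1\Big\}.$$ The algorithm $\mathsf{ALG}_{\mathrm{par}}$ takes an optimal solution $y$ of this linear program and rounds it to a random binary matrix $Y$ by the dependent rounding scheme of Gandhi, Khuller, Parthasarathy and Srinivasan: while some entry is strictly between $0$ and $1$, choose a cycle or maximal path in the bipartite graph of these entries, split its edges into two matchings $M_1,M_2$,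 let $\alpha>0$ (resp. $\beta>0$) be the least amount for which increasing $M_1$ and decreasing $M_2$ (resp. decreasing $M_1$ and increasing $M_2$) by it makes some entry of the cycle or path equal to $0$ or $1$, and make the first change with probability $\beta/(\alpha+\beta)$ and the second with probability $\alpha/(\alpha+\beta)$. For each position $j$ it lists the candidates with $Y_{ij}=1$ in decreasing order of $v_{ij}$ and runs the $k$ lists in parallel: in each of the $T$ rounds the next candidate on the list of each still unfilled position receives an offer. Write $\mathsf{ALG}_{\mathrm{par}}(I)$ for its expected total reward. **Sequential offering.** Let $I'$ be the sequential offering instance with the same candidates and $k$ positions in which at most $kT$ offers can be sent in total, one at a time: each candidate receives at most one offer and accepts it independently with probability $p_i$, in which case she is hired and yields $v_i$; at most $k$ candidates can be hired. Let $\mathsf{OPT}_{\mathrm{seq}}(I')$ be the supremum of the expected total value over all adaptive, possibly randomized, policies, and let $$\mathrm{LP}_{\mathrm{seq}}(I')=\max\Big\{\sum_i v_iy_ip_i\;:\;\sum_i y_i\le kT,\ \ \sum_i y_ip_i\le k,\ \ 0\le y_i\le 1\Big\}.$$ **Corollary.** For every parallel offering instance $I$ with identical positions, $\mathrm{LP}_{\mathrm{par}}(I)=\mathrm{LP}_{\mathrm{seq}}(I')$;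 the algorithm $\mathsf{ALG}_{\mathrm{par}}$ can be carried out on $I$; and, whatever choices it makes where its description leaves them open (the optimal solution $y$, the cycles, paths and matchings in the rounding, the order among equal values) and whatever the correlation of the decisions of each candidate across positions, $$\mathsf{ALG}_{\mathrm{par}}(I)\;\ge\;\Big(1-\frac1e\Big)\,\mathsf{OPT}_{\mathrm{seq}}(I').$$ -/

import Mathlib

namespace Hiring

/-! ## The sequential offering problem -/

/-- An instance of the sequential offering problem: `k` positions, `T` offers in total, `n`
candidates, acceptance probabilities `p` and values `v`. -/
structure SeqInstance where
  k : ℕ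
  T : ℕ
  n : ℕ
  p : Fin n → ℝ
  v : Fin n → ℝ
  p_nonneg : ∀ i, 0 ≤ p i
  p_le_one : ∀ i, p i ≤ 1
  v_nonneg : ∀ i, 0 ≤ v i

namespace SeqInstance

/-- An adaptive, possibly randomized policy. Given the offers sent so far with their responses (most
recent first), it draws the next candidate to receive an offer, or `none` to stop. -/
abbrev Policy (I : SeqInstance) : Type :=
  List (Fin I.n × Bool) → PMF (Option (Fin I.n))

/-- `I.run π acc t m h`: value collected from now on (averaged over the coin flips of the policy
`π`) when `acc i` says whether candidate `i` accepts an offer, at most `t` further offers can be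
sent, `m` positions are open, and `h` is the history. An offeree who accepts is hired. A candidate
gets at most one offer: selecting a candidate for a second time is the same as stopping. -/
noncomputable def run (I : SeqInstance) (π : I.Policy) (acc : Fin I.n → Bool) :
    ℕ → ℕ → List (Fin I.n × Bool) → ℝ
  | 0, _, _ => 0
  | _ + 1, 0, _ => 0
  | t + 1, m + 1, h => ∑ a : Option (Fin I.n), (π h a).toReal *
      match a with
      | none => 0
      | some i =>
        if i ∈ h.map Prod.fst then 0
        else if acc i = true then I.v i + run I π acc t m ((i, true) :: h)
        else run I π acc t (m + 1) ((i, false) :: h)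

/-- Probability of the acceptance pattern `acc`: candidates accept independently, candidate `i` with
probability `p i`. -/
def accProb (I : SeqInstance) (acc : Fin I.n → Bool) : ℝ :=
  ∏ i, if acc i = true then I.p i else 1 - I.p i

/-- Expected reward of a policy. -/
noncomputable def reward (I : SeqInstance) (π : I.Policy) : ℝ :=
  ∑ acc : Fin I.n → Bool, I.accProb acc * I.run π acc I.T I.k []

/-- Supremum of the expected rewards over all policies. -/
noncomputable def opt (I : SeqInstance) : ℝ :=
  ⨆ π : I.Policy, I.reward π

theorem run_le (I : SeqInstance) (π : I.Policy) (acc : Fin I.n → Bool) (t m : ℕ)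
    (h : List (Fin I.n × Bool)) : I.run π acc t m h ≤ t * ∑ i, I.v i := by
  have hV : 0 ≤ ∑ i, I.v i := Finset.sum_nonneg fun i _ => I.v_nonneg i
  induction t generalizing m h with
  | zero => simp [run]
  | succ t ih =>
    cases m with
    | zero => simp only [run]; positivity
    | succ m =>
      have hs : ∑ a : Option (Fin I.n), (π h a).toReal = 1 := by
        rw [← ENNReal.toReal_sum fun a _ => (π h).apply_ne_top a, ← tsum_fintype (L := .unconditional _),
          (π h).tsum_coe, ENNReal.toReal_one]
      rw [run, ← one_mul (((t + 1 : ℕ) : ℝ) * _), ← hs, Finset.sum_mul]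
      refine Finset.sum_le_sum fun a _ => mul_le_mul_of_nonneg_left ?_ ENNReal.toReal_nonneg
      rcases a with _ | i
      · positivity
      · have h1 : I.v i ≤ ∑ i, I.v i :=
          Finset.single_le_sum (fun i _ => I.v_nonneg i) (Finset.mem_univ i)
        have h2 := ih m ((i, true) :: h)
        have h3 := ih (m + 1) ((i, false) :: h)
        push_cast
        split_ifs
        · positivity
        · linarith
        · linarith

/-- The supremum defining `opt` is over a set of reals that is bounded above. -/
theorem bddAbove_reward (I : SeqInstance) : BddAbove (Set.range I.reward) := by
  refine ⟨∑ acc : Fin I.n → Bool, I.accProb acc * (I.T * ∑ i, I.v i), ?_⟩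
  rintro _ ⟨π, rfl⟩
  refine Finset.sum_le_sum fun acc _ => mul_le_mul_of_nonneg_left (I.run_le π acc _ _ _) ?_
  refine Finset.prod_nonneg fun i _ => ?_
  have := I.p_nonneg i
  have := I.p_le_one i
  split_ifs <;> linarith

/-- Feasible solutions of the linear program of the sequential offering problem. -/
structure LPFeasible (I : SeqInstance) (y : Fin I.n → ℝ) : Prop where
  offers : ∑ i, y i ≤ I.T
  hires : ∑ i, y i * I.p i ≤ I.k
  nonneg : ∀ i, 0 ≤ y i
  le_one : ∀ i, y i ≤ 1

/-- Optimal value of the linear program of the sequential offering problem. -/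
noncomputable def lpValue (I : SeqInstance) : ℝ :=
  sSup {z : ℝ | ∃ y, I.LPFeasible y ∧ z = ∑ i, I.v i * y i * I.p i}

end SeqInstance

/-! ## The parallel offering problem -/

/-- An instance of the parallel offering problem: `k` positions, `T` offering rounds, `n`
candidates, acceptance probabilities `p` and values `v`. -/
structure ParInstance where
  k : ℕ
  T : ℕ
  n : ℕ
  one_le_k : 1 ≤ k
  k_le_T : k ≤ T
  T_le_n : T ≤ n
  p : Fin n → Fin k → ℝ
  v : Fin n → Fin k → ℝ
  p_nonneg : ∀ i j, 0 ≤ p i j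
  p_le_one : ∀ i j, p i j ≤ 1
  v_nonneg : ∀ i j, 0 ≤ v i j

namespace ParInstance

/-- All positions are identical. -/
def IdenticalPositions (I : ParInstance) : Prop :=
  ∀ i j j', I.p i j = I.p i j' ∧ I.v i j = I.v i j'

/-- The sequential instance with the same candidates and `k` positions (`p` and `v` are read off at
the first position) in which `k * T` offers can be sent in total. -/
def toSeq (I : ParInstance) : SeqInstance where
  k := I.k
  T := I.k * I.T
  n := I.n
  p i := I.p i ⟨0, I.one_le_k⟩
  v i := I.v i ⟨0, I.one_le_k⟩
  p_nonneg i := I.p_nonneg i _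
  p_le_one i := I.p_le_one i _
  v_nonneg i := I.v_nonneg i _

/-- Which offers the candidates would accept, decided before the rounds start: `law i` is the joint
law of the decisions of candidate `i` on the `k` positions (arbitrarily correlated), and candidate
`i` accepts position `j` with probability `p i j`. -/
structure AcceptanceLaw (I : ParInstance) where
  law : Fin I.n → PMF (Fin I.k → Bool)
  marginal : ∀ i j, ∑ a : Fin I.k → Bool, (if a j = true then (law i a).toReal else 0) = I.p i j

/-- Probability of the acceptance pattern `acc`: decisions are independent across candidates. -/
noncomputable def AcceptanceLaw.prob {I : ParInstance} (D : I.AcceptanceLaw)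
    (acc : Fin I.n → Fin I.k → Bool) : ℝ :=
  ∏ i, (D.law i (acc i)).toReal

/-- Record of a round: for each position the candidate who received an offer, if any, and whether
she accepted. -/
abbrev Round (I : ParInstance) : Type := Fin I.k → Option (Fin I.n × Bool)

/-- Position `j` has been filled in one of the rounds of `h`. -/
def Filled (I : ParInstance) (h : List I.Round) (j : Fin I.k) : Prop :=
  ∃ r ∈ h, ∃ i, r j = some (i, true)

/-- Candidate `i` has received an offer in one of the rounds of `h`. -/
def Offered (I : ParInstance) (h : List I.Round) (i : Fin I.n) : Prop :=
  ∃ r ∈ h, ∃ j b, r j = some (i, b)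

/-- A (deterministic, adaptive) policy: given the past rounds (most recent first), which candidate
to send an offer for each position. -/
abbrev Policy (I : ParInstance) : Type := List I.Round → Fin I.k → Option (Fin I.n)

open Classical in
/-- The round that results when the offers `a` are proposed after history `h`. The rules of the
problem are enforced: an offer is sent only if the position is not yet filled, the candidate has not
received an offer before, and she is not proposed for another position in the same round. -/
noncomputable def playRound (I : ParInstance) (acc : Fin I.n → Fin I.k → Bool)
    (h : List I.Round) (a : Fin I.k → Option (Fin I.n)) : I.Round := fun j =>
  match a j with
  | none => none
  | some i =>
    if ¬ I.Filled h j ∧ ¬ I.Offered h i ∧ ∀ j', a j' = some i → j' = j then some (i, acc i j)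
    else none

/-- Total value of the candidates hired in a round. -/
noncomputable def roundReward (I : ParInstance) (r : I.Round) : ℝ :=
  ∑ j, match r j with
    | some (i, true) => I.v i j
    | _ => 0

/-- Value collected by the policy `π` in `t` further rounds after history `h`. -/
noncomputable def run (I : ParInstance) (π : I.Policy) (acc : Fin I.n → Fin I.k → Bool) :
    ℕ → List I.Round → ℝ
  | 0, _ => 0
  | t + 1, h =>
    I.roundReward (I.playRound acc h (π h)) + run I π acc t (I.playRound acc h (π h) :: h)

/-- Expected reward of a policy over the `T` rounds. -/
noncomputable def reward (I : ParInstance) (D : I.AcceptanceLaw) (π : I.Policy) : ℝ :=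
  ∑ acc : Fin I.n → Fin I.k → Bool, D.prob acc * I.run π acc I.T []

/-! ### The linear program -/

/-- Feasible solutions of the linear program of the parallel offering problem. -/
structure LPFeasible (I : ParInstance) (y : Fin I.n → Fin I.k → ℝ) : Prop where
  rounds : ∀ j, ∑ i, y i j ≤ I.T
  hires : ∀ j, ∑ i, y i j * I.p i j ≤ 1
  offers : ∀ i, ∑ j, y i j ≤ 1
  nonneg : ∀ i j, 0 ≤ y i j
  le_one : ∀ i j, y i j ≤ 1

/-- Objective of the linear program of the parallel offering problem. -/
def lpObjective (I : ParInstance) (y : Fin I.n → Fin I.k → ℝ) : ℝ :=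
  ∑ j, ∑ i, I.v i j * y i j * I.p i j

/-- Optimal solutions of the linear program. -/
def LPOptimal (I : ParInstance) (y : Fin I.n → Fin I.k → ℝ) : Prop :=
  I.LPFeasible y ∧ ∀ y', I.LPFeasible y' → I.lpObjective y' ≤ I.lpObjective y

/-- Optimal value of the linear program of the parallel offering problem. -/
noncomputable def lpValue (I : ParInstance) : ℝ :=
  sSup {z : ℝ | ∃ y, I.LPFeasible y ∧ z = I.lpObjective y}

end ParInstance

/-! ## Dependent rounding of Gandhi, Khuller, Parthasarathy and Srinivasan -/

/-- The bipartite graph of the floating edges of `x`, that is, of the edges `(i, j)` with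
`0 < x i j < 1`. -/
def floatingGraph {n k : ℕ} (x : Fin n → Fin k → ℝ) : SimpleGraph (Fin n ⊕ Fin k) :=
  SimpleGraph.fromRel fun a b => ∃ i j, a = Sum.inl i ∧ b = Sum.inr j ∧ 0 < x i j ∧ x i j < 1

/-- No two edges of `M` share a vertex. -/
def IsEdgeMatching {n k : ℕ} (M : Finset (Fin n × Fin k)) : Prop :=
  ∀ e ∈ M, ∀ f ∈ M, e.1 = f.1 ∨ e.2 = f.2 → e = f

/-- `M` is the edge set of the walk `w`. -/
def IsEdgeSetOf {n k : ℕ} {x : Fin n → Fin k → ℝ} {a b : Fin n ⊕ Fin k}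
    (M : Finset (Fin n × Fin k)) (w : (floatingGraph x).Walk a b) : Prop :=
  ∀ i j, (i, j) ∈ M ↔ s(Sum.inl i, Sum.inr j) ∈ w.edges

/-- `M` is the edge set of a cycle of floating edges, or of a maximal path of floating edges: one
with at least one edge, at whose two ends there is no floating edge that is not on the path. -/
def IsCycleOrMaximalPath {n k : ℕ} (x : Fin n → Fin k → ℝ) (M : Finset (Fin n × Fin k)) : Prop :=
  (∃ (a : Fin n ⊕ Fin k) (w : (floatingGraph x).Walk a a), w.IsCycle ∧ IsEdgeSetOf M w) ∨
  (∃ (a b : Fin n ⊕ Fin k) (w : (floatingGraph x).Walk a b), w.IsPath ∧ ¬ w.Nil ∧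
    IsEdgeSetOf M w ∧
    (∀ c, (floatingGraph x).Adj a c → s(a, c) ∈ w.edges) ∧
    (∀ c, (floatingGraph x).Adj b c → s(b, c) ∈ w.edges))

/-- Add `γ` to `x` on the edges of `M₁` and subtract it on the edges of `M₂`. -/
def shift {n k : ℕ} (x : Fin n → Fin k → ℝ) (M₁ M₂ : Finset (Fin n × Fin k)) (γ : ℝ) :
    Fin n → Fin k → ℝ := fun i j =>
  x i j + (if (i, j) ∈ M₁ then γ else 0) - (if (i, j) ∈ M₂ then γ else 0)

/-- The smallest `γ > 0` for which shifting makes some edge of `M₁` equal to `1` or some edge of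
`M₂` equal to `0`. -/
def IsStepSize {n k : ℕ} (x : Fin n → Fin k → ℝ) (M₁ M₂ : Finset (Fin n × Fin k)) (γ : ℝ) : Prop :=
  IsLeast {γ : ℝ | 0 < γ ∧
    ((∃ e ∈ M₁, x e.1 e.2 + γ = 1) ∨ (∃ e ∈ M₂, x e.1 e.2 - γ = 0))} γ

/-- `GKPS x μ`: the dependent rounding scheme, started at the edge weights `x` of the complete
bipartite graph, can be run so that its output has law `μ`. If no edge is floating, the weights are
returned. Otherwise a cycle or maximal path of floating edges is chosen and split into two matchings
`M₁`, `M₂`, the weights are moved by `α` in one direction with probability `β / (α + β)` and by `β`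
in the other direction with probability `α / (α + β)`, and the scheme goes on from the new weights.
The choices in each step are left open. -/
inductive GKPS {n k : ℕ} : (Fin n → Fin k → ℝ) → PMF (Fin n → Fin k → Bool) → Prop
  | done (x : Fin n → Fin k → ℝ) (Y : Fin n → Fin k → Bool)
      (hY : ∀ i j, x i j = if Y i j = true then 1 else 0) : GKPS x (PMF.pure Y)
  | step (x : Fin n → Fin k → ℝ) (M₁ M₂ : Finset (Fin n × Fin k)) (α β : ℝ)
      (μ₁ μ₂ μ : PMF (Fin n → Fin k → Bool))
      (hP : IsCycleOrMaximalPath x (M₁ ∪ M₂)) (hdisj : Disjoint M₁ M₂)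
      (hM₁ : IsEdgeMatching M₁) (hM₂ : IsEdgeMatching M₂)
      (hα : IsStepSize x M₁ M₂ α) (hβ : IsStepSize x M₂ M₁ β)
      (h₁ : GKPS (shift x M₁ M₂ α) μ₁) (h₂ : GKPS (shift x M₂ M₁ β) μ₂)
      (hμ : ∀ Y, (μ Y).toReal =
        β / (α + β) * (μ₁ Y).toReal + α / (α + β) * (μ₂ Y).toReal) : GKPS x μ

/-! ## The algorithm for parallel offering -/

namespace ParInstance

/-- The policy that runs the lists `L j` in parallel: in round `t`, if position `j` is not filled
yet, the offer for position `j` goes to the `t`-th candidate of `L j` (if there is one). -/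
noncomputable def listPolicy (I : ParInstance) (L : Fin I.k → List (Fin I.n)) : I.Policy :=
  open Classical in fun h j => if I.Filled h j then none else (L j)[h.length]?

/-- An execution of the algorithm, that is, the choices that its description leaves open: an optimal
solution `y` of the linear program, the choices in the dependent rounding of `y`, recorded by the
law `μ` of its output `Y`, and, for each `Y` and each position `j`, a list `L Y j` of the candidates
`i` with `Y i j = 1` in decreasing order of `v i j` (ties in any order). -/
structure AlgPar (I : ParInstance) where
  y : Fin I.n → Fin I.k → ℝ
  optimal : I.LPOptimal y
  μ : PMF (Fin I.n → Fin I.k → Bool)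
  rounding : GKPS y μ
  L : (Fin I.n → Fin I.k → Bool) → Fin I.k → List (Fin I.n)
  nodup : ∀ Y j, (L Y j).Nodup
  mem_iff : ∀ Y j i, i ∈ L Y j ↔ Y i j = true
  sorted : ∀ Y j, (L Y j).Pairwise fun a b => I.v b j ≤ I.v a j

/-- Expected reward of the algorithm, over the rounding and the (independent) decisions of the
candidates. -/
noncomputable def AlgPar.reward {I : ParInstance} (A : I.AlgPar) (D : I.AcceptanceLaw) : ℝ :=
  ∑ Y : Fin I.n → Fin I.k → Bool, (A.μ Y).toReal * I.reward D (I.listPolicy (A.L Y))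

end ParInstance

end Hiring

namespace Hiring

/-! ## Sums over acceptance patterns -/

/-! Both sides are compared through the linear programs: the reward of the algorithm is at least `(1
- 1 / e)` times the LP objective of `y`, and this objective equals `LP_par = LP_seq`, which is at
least `OPT_seq`.

Upper bound: under any policy, the probabilities that the candidates receive an offer are feasible
for the sequential LP, with objective equal to the expected reward (`SeqInstance.exists_offerProb`).
This uses that the decision to make an offer is independent of the response of its recipient. For
identical positions the two LPs agree (`lpValue_eq_lpValue_toSeq`): sum a parallel solution over the
positions, or spread a sequential one evenly over them.

Lower bound (`AlgPar.le_reward`): the rounding keeps integral degree bounds (`GKPS.degree_le`), so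
the lists are disjoint and have length at most `T`. No rule then blocks an offer, and position `j`
simply yields the value of the first acceptor on its list (`run_listPolicy_nil`). Since the list is
sorted by value, this is a nonnegative combination, over thresholds `τ`, of the events that some
listed candidate of value at least `τ` accepts (`firstValue_eq_sum_layers`). Each event concerns one
position only, so correlation across positions is irrelevant. By negative correlation
(`GKPS.sum_prod_le`) the event fails with probability at most `∏ (1 - p y)`, and `∑ p y ≤ 1` gives
`1 - ∏ (1 - p y) ≥ (1 - 1 / e) ∑ p y` (`one_sub_prod_ge`). Summing over thresholds and positions
recovers the LP objective. -/

theorem two_mul_sum_apply_mul {ι : Type*} [Fintype ι] [DecidableEq ι] (i : ι) (φ : Bool → ℝ)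
    (H : (ι → Bool) → ℝ) (hH : ∀ a b, H (Function.update a i b) = H a) :
    2 * ∑ a, φ (a i) * H a = (φ true + φ false) * ∑ a, H a := by
  -- Flipping coordinate `i` is an involution that leaves `H` unchanged; averaging the sum with its
  -- flipped copy separates `φ` from `H`.
  have hflip : ∑ a : ι → Bool, φ (a i) * H a = ∑ a : ι → Bool, φ (!a i) * H a := by
    refine Fintype.sum_bijective (fun a => Function.update a i (!a i)) ?_ _ _ fun a => ?_
    · refine Function.Involutive.bijective fun a => ?_
      simp
    · simp [hH]
  rw [two_mul]
  nth_rewrite 2 [hflip]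
  rw [← Finset.sum_add_distrib, Finset.mul_sum]
  refine Finset.sum_congr rfl fun a _ => ?_
  cases a i <;> simp <;> ring

theorem PMF.sum_toReal {α : Type*} [Fintype α] (μ : PMF α) : ∑ a, (μ a).toReal = 1 := by
  rw [← ENNReal.toReal_sum fun a _ => μ.apply_ne_top a, ← tsum_fintype (L := .unconditional _),
    μ.tsum_coe, ENNReal.toReal_one]

/-! ### The sequential linear program bounds every adaptive policy -/

namespace SeqInstance

variable (I : SeqInstance)

theorem accProb_eq_mul (acc : Fin I.n → Bool) (i : Fin I.n) :
    I.accProb acc = (if acc i = true then I.p i else 1 - I.p i) *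
      ∏ j ∈ Finset.univ.erase i, if acc j = true then I.p j else 1 - I.p j := by
  rw [accProb]
  exact (Finset.mul_prod_erase _ (fun j => if acc j = true then I.p j else 1 - I.p j)
    (Finset.mem_univ i)).symm

theorem sum_accProb : ∑ acc, I.accProb acc = 1 := by
  have h := Fintype.prod_sum fun (i : Fin I.n) (b : Bool) => if b = true then I.p i else 1 - I.p i
  simp only [accProb]
  rw [← h]
  simp

/-- The response of candidate `i` is independent of everything that depends only on the responses
of the others. -/
theorem sum_accProb_ite (i : Fin I.n) (F G : (Fin I.n → Bool) → ℝ)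
    (hF : ∀ a b, F (Function.update a i b) = F a) (hG : ∀ a b, G (Function.update a i b) = G a) :
    ∑ acc, I.accProb acc * (if acc i = true then F acc else G acc) =
      I.p i * ∑ acc, I.accProb acc * F acc + (1 - I.p i) * ∑ acc, I.accProb acc * G acc := by
  set P : (Fin I.n → Bool) → ℝ := fun acc =>
    ∏ j ∈ Finset.univ.erase i, if acc j = true then I.p j else 1 - I.p j
  have hP : ∀ a b, P (Function.update a i b) = P a := fun a b =>
    Finset.prod_congr rfl fun j hj => by rw [Function.update_of_ne (Finset.ne_of_mem_erase hj)]
  have hacc : ∀ acc, I.accProb acc = (if acc i = true then I.p i else 1 - I.p i) * P acc :=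
    fun acc => I.accProb_eq_mul acc i
  have hPF : ∀ a b, P (Function.update a i b) * F (Function.update a i b) = P a * F a := by
    intro a b; rw [hP, hF]
  have hPG : ∀ a b, P (Function.update a i b) * G (Function.update a i b) = P a * G a := by
    intro a b; rw [hP, hG]
  have e1 := two_mul_sum_apply_mul i (fun b => if b = true then I.p i else 0)
    (fun a => P a * F a) hPF
  have e2 := two_mul_sum_apply_mul i (fun b => if b = true then 0 else 1 - I.p i)
    (fun a => P a * G a) hPG
  have e3 := two_mul_sum_apply_mul i (fun b => if b = true then I.p i else 1 - I.p i)
    (fun a => P a * F a) hPF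
  have e4 := two_mul_sum_apply_mul i (fun b => if b = true then I.p i else 1 - I.p i)
    (fun a => P a * G a) hPG
  have s : ∑ acc, I.accProb acc * (if acc i = true then F acc else G acc) =
      ∑ a : Fin I.n → Bool, (if a i = true then I.p i else 0) * (P a * F a) +
      ∑ a : Fin I.n → Bool, (if a i = true then 0 else 1 - I.p i) * (P a * G a) := by
    rw [← Finset.sum_add_distrib]
    refine Finset.sum_congr rfl fun a _ => ?_
    rw [hacc]
    split_ifs <;> ring
  have sF : ∑ acc, I.accProb acc * F acc =
      ∑ a : Fin I.n → Bool, (if a i = true then I.p i else 1 - I.p i) * (P a * F a) :=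
    Finset.sum_congr rfl fun a _ => by rw [hacc, mul_assoc]
  have sG : ∑ acc, I.accProb acc * G acc =
      ∑ a : Fin I.n → Bool, (if a i = true then I.p i else 1 - I.p i) * (P a * G a) :=
    Finset.sum_congr rfl fun a _ => by rw [hacc, mul_assoc]
  rw [s, sF, sG]
  simp only [if_true, Bool.false_eq_true, if_false] at e1 e2 e3 e4
  -- All four sums are now multiples of `∑ P * F` or `∑ P * G`; the weights of the two responses add
  -- up to `1`.
  linear_combination (1 / 2) * e1 + (1 / 2) * e2 - (I.p i / 2) * e3 - ((1 - I.p i) / 2) * e4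

/-- Once `i` is in the history her response is never consulted again, because selecting her a second
time ends the run. This supplies the independence needed in `sum_accProb_ite`. -/
theorem run_update (π : I.Policy) (i : Fin I.n) (b : Bool) (acc : Fin I.n → Bool) (t m : ℕ)
    (h : List (Fin I.n × Bool)) (hi : i ∈ h.map Prod.fst) :
    I.run π (Function.update acc i b) t m h = I.run π acc t m h := by
  induction t generalizing m h with
  | zero => simp [run]
  | succ t ih =>
    cases m with
    | zero => simp [run]
    | succ m =>
      rw [run, run]
      refine Finset.sum_congr rfl fun a _ => ?_
      rcases a with _ | i'
      · rfl
      · by_cases hi' : i' ∈ h.map Prod.fst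
        · simp only [hi', if_true]
        · have hne : i' ≠ i := by rintro rfl; exact hi' hi
          have h1 : ∀ c, i ∈ ((i', c) :: h).map Prod.fst := fun c => by
            simp only [List.map_cons, List.mem_cons]; exact Or.inr hi
          simp only [hi', if_false, Function.update_of_ne hne, ih _ _ (h1 _)]

/-- The offer probabilities of a policy satisfy the constraints of the linear program. -/
theorem exists_offerProb (π : I.Policy) (t m : ℕ) (h : List (Fin I.n × Bool)) :
    ∃ y : Fin I.n → ℝ, (∀ i, 0 ≤ y i) ∧ (∀ i, y i ≤ 1) ∧ (∀ i ∈ h.map Prod.fst, y i = 0) ∧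
      ∑ i, y i ≤ t ∧ ∑ i, y i * I.p i ≤ m ∧
      ∑ acc, I.accProb acc * I.run π acc t m h = ∑ i, I.v i * y i * I.p i := by
  induction t generalizing m h with
  | zero => exact ⟨0, by simp, by simp, by simp, by simp, by simp, by simp [run]⟩
  | succ t ih =>
    cases m with
    | zero =>
      exact ⟨0, by simp, by simp, by simp, by simp; positivity, by simp, by simp [run]⟩
    | succ m =>
      have hz : ∃ y : Fin I.n → ℝ, (∀ i, 0 ≤ y i) ∧ (∀ i, y i ≤ 1) ∧
          (∀ i ∈ h.map Prod.fst, y i = 0) ∧ ∑ i, y i ≤ (t + 1 : ℕ) ∧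
          ∑ i, y i * I.p i ≤ (m + 1 : ℕ) ∧ 0 = ∑ i, I.v i * y i * I.p i :=
        ⟨0, by simp, by simp, by simp, by simp; positivity, by simp; positivity, by simp⟩
      -- The claim is first shown conditionally on the draw `a` of the policy, then averaged over
      -- the draw.
      have key : ∀ a : Option (Fin I.n), ∃ y : Fin I.n → ℝ, (∀ i, 0 ≤ y i) ∧ (∀ i, y i ≤ 1) ∧
          (∀ i ∈ h.map Prod.fst, y i = 0) ∧ ∑ i, y i ≤ (t + 1 : ℕ) ∧
          ∑ i, y i * I.p i ≤ (m + 1 : ℕ) ∧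
          (∑ acc, I.accProb acc * (match a with
            | none => 0
            | some i =>
              if i ∈ h.map Prod.fst then 0
              else if acc i = true then I.v i + I.run π acc t m ((i, true) :: h)
              else I.run π acc t (m + 1) ((i, false) :: h))) = ∑ i, I.v i * y i * I.p i := by
        rintro (_ | i)
        · simpa using hz
        · by_cases hi : i ∈ h.map Prod.fst
          · simpa only [hi, if_true, mul_zero, Finset.sum_const_zero] using hz
          obtain ⟨y₁, n₁, l₁, z₁, s₁, q₁, e₁⟩ := ih m ((i, true) :: h)
          obtain ⟨y₂, n₂, l₂, z₂, s₂, q₂, e₂⟩ := ih (m + 1) ((i, false) :: h)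
          have hp := I.p_nonneg i
          have hp' : 0 ≤ 1 - I.p i := sub_nonneg.2 (I.p_le_one i)
          have sum_eq : ∀ w : Fin I.n → ℝ,
              ∑ i', w i' * (Pi.single (M := fun _ => ℝ) i 1 i' + I.p i * y₁ i' +
                (1 - I.p i) * y₂ i') =
              w i + I.p i * ∑ i', w i' * y₁ i' + (1 - I.p i) * ∑ i', w i' * y₂ i' := by
            intro w
            have : ∑ i', w i' * Pi.single (M := fun _ => ℝ) i 1 i' = w i := by
              simp [Pi.single_apply]
            rw [Finset.mul_sum, Finset.mul_sum, ← this, ← Finset.sum_add_distrib,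
              ← Finset.sum_add_distrib]
            exact Finset.sum_congr rfl fun i' _ => by ring
          -- Candidate `i` receives this offer for certain; the later offers follow `y₁` after an
          -- acceptance and `y₂` after a rejection.
          refine ⟨fun i' => Pi.single (M := fun _ => ℝ) i 1 i' + I.p i * y₁ i' +
            (1 - I.p i) * y₂ i', fun i' => ?_, fun i' => ?_, fun i' hi' => ?_, ?_, ?_, ?_⟩
          · have h0 : 0 ≤ Pi.single (M := fun _ => ℝ) i 1 i' := by
              rw [Pi.single_apply]; split_ifs <;> norm_num
            have := mul_nonneg hp (n₁ i')
            have := mul_nonneg hp' (n₂ i')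
            dsimp only
            linarith
          · dsimp only
            rcases eq_or_ne i' i with rfl | hne
            -- Both continuations have `i` in their history, so they put no weight on her. This is
            -- why vanishing on the history is part of the induction.
            · rw [z₁ i' (by simp), z₂ i' (by simp)]; simp
            · rw [Pi.single_eq_of_ne hne]
              have := mul_le_mul_of_nonneg_left (l₁ i') hp
              have := mul_le_mul_of_nonneg_left (l₂ i') hp'
              linarith
          · dsimp only
            have hne : i' ≠ i := by rintro rfl; exact hi hi'
            rw [Pi.single_eq_of_ne hne, z₁ i' (by rw [List.map_cons]; exact List.mem_cons_of_mem _ hi'),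
              z₂ i' (by rw [List.map_cons]; exact List.mem_cons_of_mem _ hi')]
            simp
          · have := sum_eq fun _ => 1
            simp only [one_mul] at this
            rw [this]
            have := mul_le_mul_of_nonneg_left s₁ hp
            have := mul_le_mul_of_nonneg_left s₂ hp'
            push_cast
            linarith
          -- The hiring budget closes exactly: `p i + p i * m + (1 - p i) * (m + 1) = m + 1`.
          · have := sum_eq I.p
            simp only [mul_comm (I.p _) (_ + _)] at this
            rw [this]
            have e1 := mul_le_mul_of_nonneg_left q₁ hp
            have e2 := mul_le_mul_of_nonneg_left q₂ hp'
            simp only [mul_comm (I.p _) (y₁ _), mul_comm (I.p _) (y₂ _)]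
            push_cast at e2 ⊢
            linarith
          · have hrun : ∀ (c : Bool) (m' : ℕ) (a : Fin I.n → Bool) (b : Bool),
                I.run π (Function.update a i b) t m' ((i, c) :: h) =
                  I.run π a t m' ((i, c) :: h) :=
              fun c m' a b => I.run_update π i b a t m' _ (by simp)
            have h3 := I.sum_accProb_ite i
              (fun acc => I.v i + I.run π acc t m ((i, true) :: h))
              (fun acc => I.run π acc t (m + 1) ((i, false) :: h))
              (fun a b => by rw [hrun]) (fun a b => by rw [hrun])
            simp only [hi, if_false]
            rw [h3, e₂]
            simp only [mul_add, Finset.sum_add_distrib]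
            rw [e₁, ← Finset.sum_mul, I.sum_accProb]
            have h4 := sum_eq fun i' => I.v i' * I.p i'
            have h5 : ∀ w : Fin I.n → ℝ, ∑ i', I.v i' * w i' * I.p i' =
                ∑ i', I.v i' * I.p i' * w i' :=
              fun w => Finset.sum_congr rfl fun _ _ => by ring
            have h6 := h5 fun i' => Pi.single (M := fun _ => ℝ) i 1 i' + I.p i * y₁ i' +
                (1 - I.p i) * y₂ i'
            have h7 : ∑ i', I.v i' * (Pi.single (M := fun _ => ℝ) i 1 i' + I.p i * y₁ i' +
                (1 - I.p i) * y₂ i') * I.p i' =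
                I.v i * I.p i + I.p i * ∑ i', I.v i' * y₁ i' * I.p i' +
                (1 - I.p i) * ∑ i', I.v i' * y₂ i' * I.p i' := by
              rw [h5 y₁, h5 y₂, ← h4, ← h6]
            simp only [mul_add, add_mul, Finset.sum_add_distrib] at h7 ⊢
            rw [h7]
            ring
      choose Y hY0 hY1 hYh hYt hYm hYe using key
      have hw : ∀ a, 0 ≤ (π h a).toReal := fun a => ENNReal.toReal_nonneg
      have hs : ∑ a, (π h a).toReal = 1 := PMF.sum_toReal _
      have avg : ∀ (f : Option (Fin I.n) → ℝ) (B : ℝ), (∀ a, f a ≤ B) →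
          ∑ a, (π h a).toReal * f a ≤ B := by
        intro f B hf
        calc _ ≤ ∑ a, (π h a).toReal * B :=
              Finset.sum_le_sum fun a _ => mul_le_mul_of_nonneg_left (hf a) (hw a)
          _ = B := by rw [← Finset.sum_mul, hs, one_mul]
      refine ⟨fun i => ∑ a, (π h a).toReal * Y a i, fun i => ?_, fun i => ?_, fun i hi => ?_,
        ?_, ?_, ?_⟩
      · exact Finset.sum_nonneg fun a _ => mul_nonneg (hw a) (hY0 a i)
      · exact avg _ _ fun a => hY1 a i
      · exact Finset.sum_eq_zero fun a _ => by rw [hYh a i hi, mul_zero]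
      · rw [Finset.sum_comm]
        simp only [← Finset.mul_sum]
        exact avg _ _ hYt
      · simp only [Finset.sum_mul]
        rw [Finset.sum_comm]
        simp only [mul_assoc, ← Finset.mul_sum]
        exact avg _ _ hYm
      · simp only [run, Finset.mul_sum, Finset.sum_mul]
        rw [Finset.sum_comm, Finset.sum_comm (s := (Finset.univ : Finset (Fin I.n)))]
        refine Finset.sum_congr rfl fun a _ => ?_
        have h1 := hYe a
        have h2 := congrArg (fun z => (π h a).toReal * z) h1
        simp only [Finset.mul_sum] at h2
        refine Eq.trans (Finset.sum_congr rfl fun acc _ => mul_left_comm _ _ _) (h2.trans ?_)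
        exact Finset.sum_congr rfl fun i _ => by ring

theorem bddAbove_lp : BddAbove {z : ℝ | ∃ y, I.LPFeasible y ∧ z = ∑ i, I.v i * y i * I.p i} := by
  refine ⟨∑ i, I.v i * I.p i, ?_⟩
  rintro _ ⟨y, hy, rfl⟩
  refine Finset.sum_le_sum fun i _ => mul_le_mul_of_nonneg_right ?_ (I.p_nonneg i)
  exact mul_le_of_le_one_right (I.v_nonneg i) (hy.le_one i)

theorem opt_le_lpValue : I.opt ≤ I.lpValue := by
  have : Nonempty I.Policy := ⟨fun _ => PMF.pure none⟩
  refine ciSup_le fun π => ?_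
  obtain ⟨y, h0, h1, -, ht, hm, he⟩ := I.exists_offerProb π I.T I.k []
  exact le_csSup I.bddAbove_lp ⟨y, ⟨ht, hm, h0, h1⟩, he⟩

end SeqInstance

/-! ### The parallel linear program: comparison with the sequential one, existence of an optimum -/

namespace ParInstance

variable (I : ParInstance)

theorem lpObjective_le_of_feasible {y : Fin I.n → Fin I.k → ℝ} (hy : I.LPFeasible y) :
    I.lpObjective y ≤ ∑ j, ∑ i, I.v i j * I.p i j := by
  refine Finset.sum_le_sum fun j _ => Finset.sum_le_sum fun i _ =>
    mul_le_mul_of_nonneg_right ?_ (I.p_nonneg i j)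
  exact mul_le_of_le_one_right (I.v_nonneg i j) (hy.le_one i j)

theorem bddAbove_lp : BddAbove {z : ℝ | ∃ y, I.LPFeasible y ∧ z = I.lpObjective y} := by
  refine ⟨∑ j, ∑ i, I.v i j * I.p i j, ?_⟩
  rintro _ ⟨y, hy, rfl⟩
  exact I.lpObjective_le_of_feasible hy

theorem lpFeasible_zero : I.LPFeasible 0 := by
  constructor <;> simp

variable {I} in
theorem LPOptimal.lpValue_eq {y : Fin I.n → Fin I.k → ℝ} (hy : I.LPOptimal y) :
    I.lpValue = I.lpObjective y := by
  refine IsGreatest.csSup_eq ⟨⟨y, hy.1, rfl⟩, ?_⟩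
  rintro _ ⟨y', hy', rfl⟩
  exact hy.2 y' hy'

/-- A parallel solution is mapped to its row sums `∑ j, y i j`, a sequential one to the constant
rows `y i / k`. With identical positions both maps preserve the objective, and the constraints of
the `k` positions add up to, or are an even share of, the sequential ones. -/
theorem lpValue_eq_lpValue_toSeq (hI : I.IdenticalPositions) : I.lpValue = I.toSeq.lpValue := by
  have hk : (0 : ℝ) < I.k := by exact_mod_cast I.one_le_k
  have hp : ∀ i j, I.p i j = I.p i ⟨0, I.one_le_k⟩ := fun i j => (hI i j _).1
  have hv : ∀ i j, I.v i j = I.v i ⟨0, I.one_le_k⟩ := fun i j => (hI i j _).2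
  apply le_antisymm
  · refine csSup_le ⟨_, 0, I.lpFeasible_zero, rfl⟩ ?_
    rintro _ ⟨y, hy, rfl⟩
    refine le_csSup I.toSeq.bddAbove_lp ⟨fun i => ∑ j, y i j, ⟨?_, ?_, ?_, ?_⟩, ?_⟩
    · have h : ∑ j, ∑ i, y i j ≤ ∑ _j : Fin I.k, (I.T : ℝ) := Finset.sum_le_sum fun j _ => hy.rounds j
      rw [Finset.sum_comm, Finset.sum_const, Finset.card_univ, Fintype.card_fin, nsmul_eq_mul,
        ← Nat.cast_mul] at h
      exact h
    · have h : ∑ j, ∑ i, y i j * I.p i j ≤ ∑ _j : Fin I.k, (1 : ℝ) :=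
        Finset.sum_le_sum fun j _ => hy.hires j
      rw [Finset.sum_comm, Finset.sum_const, Finset.card_univ, Fintype.card_fin, nsmul_eq_mul,
        mul_one] at h
      simp only [hp, ← Finset.sum_mul] at h
      exact h
    · exact fun i => Finset.sum_nonneg fun j _ => hy.nonneg i j
    · exact hy.offers
    · rw [lpObjective, Finset.sum_comm]
      simp only [hp, hv, ← Finset.sum_mul, ← Finset.mul_sum]
      rfl
  · refine csSup_le ⟨_, 0, ⟨by simp, by simp, by simp, by simp⟩, rfl⟩ ?_
    rintro _ ⟨y, ⟨ht, hh, h0, h1⟩, rfl⟩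
    change Fin I.n → ℝ at y
    change ∑ i : Fin I.n, y i ≤ ((I.k * I.T : ℕ) : ℝ) at ht
    change ∑ i : Fin I.n, y i * I.p i ⟨0, I.one_le_k⟩ ≤ (I.k : ℝ) at hh
    change ∀ i : Fin I.n, 0 ≤ y i at h0
    change ∀ i : Fin I.n, y i ≤ 1 at h1
    change ∑ i : Fin I.n, I.v i ⟨0, I.one_le_k⟩ * y i * I.p i ⟨0, I.one_le_k⟩ ≤ _
    refine le_csSup I.bddAbove_lp ⟨fun i _ => y i / I.k, ⟨?_, ?_, ?_, ?_, ?_⟩, ?_⟩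
    · intro j
      rw [← Finset.sum_div, div_le_iff₀ hk, mul_comm]
      exact_mod_cast ht
    · intro j
      simp only [hp, div_mul_eq_mul_div]
      rw [← Finset.sum_div, div_le_iff₀ hk, one_mul]
      exact hh
    · intro i
      simp only [Finset.sum_const, Finset.card_univ, Fintype.card_fin, nsmul_eq_mul]
      rw [mul_div_cancel₀ _ hk.ne']
      exact h1 i
    · exact fun i _ => div_nonneg (h0 i) hk.le
    · intro i j
      have hk1 : (1 : ℝ) ≤ I.k := by exact_mod_cast I.one_le_k
      exact (div_le_self (h0 i) hk1).trans (h1 i)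
    · simp only [lpObjective, hp _ (_ : Fin I.k), hv _ (_ : Fin I.k), Finset.sum_const, Finset.card_univ,
        Fintype.card_fin, nsmul_eq_mul, Finset.mul_sum]
      refine Finset.sum_congr rfl fun i _ => ?_
      field_simp

theorem exists_lpOptimal : ∃ y, I.LPOptimal y := by
  have hset : {y | I.LPFeasible y} =
      Set.Icc (0 : Fin I.n → Fin I.k → ℝ) 1 ∩ ({y | ∀ j, ∑ i, y i j ≤ I.T} ∩
        ({y | ∀ j, ∑ i, y i j * I.p i j ≤ 1} ∩ {y | ∀ i, ∑ j, y i j ≤ 1})) := by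
    ext y
    constructor
    · exact fun h => ⟨⟨h.nonneg, h.le_one⟩, h.rounds, h.hires, h.offers⟩
    · exact fun h => ⟨h.2.1, h.2.2.1, h.2.2.2, h.1.1, h.1.2⟩
  have hcomp : IsCompact {y | I.LPFeasible y} := by
    rw [hset]
    refine isCompact_Icc.inter_right (IsClosed.inter ?_ (IsClosed.inter ?_ ?_)) <;>
    · simp only [Set.ofPred_forall]
      exact isClosed_iInter fun _ => isClosed_le (by fun_prop) (by fun_prop)
  have hcont : Continuous I.lpObjective := by
    unfold lpObjective
    fun_prop
  obtain ⟨y, hy, hmax⟩ := hcomp.exists_isMaxOn ⟨0, I.lpFeasible_zero⟩ hcont.continuousOn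
  exact ⟨y, hy, fun y' hy' => hmax hy'⟩

end ParInstance

/-! ## Cycles and maximal paths in finite graphs -/

section Graph

variable {V : Type*} {G : SimpleGraph V}

/-- An edge from the start to a vertex of the path, if not on the path, would close a cycle; one to
a vertex off the path would give a longer path. -/
theorem mem_edges_of_adj_start {a b : V} {w : G.Walk a b} (hw : w.IsPath)
    (hcyc : ∀ (c : V) (q : G.Walk c c), ¬ q.IsCycle)
    (hmax : ∀ (c d : V) (q : G.Walk c d), q.IsPath → q.length ≤ w.length) {c : V}
    (hc : G.Adj a c) : s(a, c) ∈ w.edges := by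
  classical
  by_contra hne
  by_cases hs : c ∈ w.support
  · refine hcyc c (SimpleGraph.Walk.cons hc.symm (w.takeUntil c hs)) ?_
    rw [SimpleGraph.Walk.cons_isCycle_iff]
    refine ⟨hw.takeUntil hs, fun he => hne ?_⟩
    rw [Sym2.eq_swap]
    exact w.edges_takeUntil_subset_edges hs he
  · have h := hmax _ _ (SimpleGraph.Walk.cons hc.symm w) (hw.cons hs)
    rw [SimpleGraph.Walk.length_cons] at h
    omega

/-- A finite graph with an edge has a cycle or a path of positive length that cannot be extended. -/
theorem exists_isCycle_or_maximal_isPath [Finite V] {u v : V} (huv : G.Adj u v) :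
    (∃ (a : V) (w : G.Walk a a), w.IsCycle) ∨
      ∃ (a b : V) (w : G.Walk a b), w.IsPath ∧ ¬ w.Nil ∧
        (∀ c, G.Adj a c → s(a, c) ∈ w.edges) ∧ (∀ c, G.Adj b c → s(b, c) ∈ w.edges) := by
  by_cases hcyc : ∃ (a : V) (w : G.Walk a a), w.IsCycle
  · exact Or.inl hcyc
  refine Or.inr ?_
  push Not at hcyc
  have := Fintype.ofFinite V
  set s : Set ℕ := {m | ∃ (a b : V) (w : G.Walk a b), w.IsPath ∧ w.length = m}
  have hb : BddAbove s := by
    refine ⟨Fintype.card V, ?_⟩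
    rintro _ ⟨a, b, w, hw, rfl⟩
    exact hw.length_lt.le
  -- The given edge is a path of length one, so a longest path is not trivial.
  have h1 : 1 ∈ s :=
    ⟨u, v, huv.toWalk, SimpleGraph.Walk.IsPath.of_adj huv, by simp⟩
  obtain ⟨a, b, w, hw, hlen⟩ := Nat.sSup_mem ⟨1, h1⟩ hb
  have hmax : ∀ (c d : V) (q : G.Walk c d), q.IsPath → q.length ≤ w.length := fun c d q hq =>
    hlen ▸ le_csSup hb ⟨c, d, q, hq, rfl⟩
  refine ⟨a, b, w, hw, ?_, fun c hc => mem_edges_of_adj_start hw hcyc hmax hc, fun c hc => ?_⟩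
  · rw [SimpleGraph.Walk.not_nil_iff_lt_length, hlen]
    exact le_csSup hb h1
  · have := mem_edges_of_adj_start hw.reverse hcyc (by simpa using hmax) hc
    simpa using this

/-- An inner vertex has degree two in a path. Hence a vertex with a single path edge is an end,
where maximality applies. -/
theorem exists_mem_edges_ne_of_isPath {a b v z : V} {w : G.Walk a b} (hw : w.IsPath)
    (hva : v ≠ a) (hvb : v ≠ b) (hz : s(v, z) ∈ w.edges) : ∃ z', z' ≠ z ∧ s(v, z') ∈ w.edges := by
  obtain ⟨i, hi, hil⟩ := SimpleGraph.Walk.mem_support_iff_exists_getVert.1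
    (w.fst_mem_support_of_mem_edges hz)
  have h0 : i ≠ 0 := by rintro rfl; exact hva (by rw [← hi, w.getVert_zero])
  have hl : i < w.length := lt_of_le_of_ne hil (by rintro rfl; exact hvb (by rw [← hi, w.getVert_length]))
  have h2 := hw.ncard_neighborSet_toSubgraph_internal_eq_two h0 hl
  rw [hi] at h2
  obtain ⟨z', hz', hne⟩ := Set.exists_ne_of_one_lt_ncard (by rw [h2]; norm_num) z
  exact ⟨z', hne, SimpleGraph.Walk.adj_toSubgraph_iff_mem_edges.1 hz'⟩

theorem exists_mem_edges_ne_of_isCycle {a v z : V} {w : G.Walk a a} (hw : w.IsCycle)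
    (hz : s(v, z) ∈ w.edges) : ∃ z', z' ≠ z ∧ s(v, z') ∈ w.edges := by
  have h2 := hw.ncard_neighborSet_toSubgraph_eq_two (w.fst_mem_support_of_mem_edges hz)
  obtain ⟨z', hz', hne⟩ := Set.exists_ne_of_one_lt_ncard (by rw [h2]; norm_num) z
  exact ⟨z', hne, SimpleGraph.Walk.adj_toSubgraph_iff_mem_edges.1 hz'⟩

end Graph

/-! ## Runs of the dependent rounding scheme -/

section Rounding

variable {n k : ℕ} {x : Fin n → Fin k → ℝ} {M M₁ M₂ : Finset (Fin n × Fin k)} {γ : ℝ}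

theorem floatingGraph_adj_inl_inr {i : Fin n} {j : Fin k} :
    (floatingGraph x).Adj (Sum.inl i) (Sum.inr j) ↔ 0 < x i j ∧ x i j < 1 := by
  simp [floatingGraph, SimpleGraph.fromRel_adj]

theorem floatingGraph_adj_iff {a b : Fin n ⊕ Fin k} : (floatingGraph x).Adj a b ↔
    ∃ i j, (0 < x i j ∧ x i j < 1) ∧
      (a = Sum.inl i ∧ b = Sum.inr j ∨ a = Sum.inr j ∧ b = Sum.inl i) := by
  rcases a with i | j <;> rcases b with i' | j' <;> simp [floatingGraph, SimpleGraph.fromRel_adj]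

/-- The edges traversed from left to right and those traversed from right to left. -/
theorem exists_matchings_of_walk {a b : Fin n ⊕ Fin k} (w : (floatingGraph x).Walk a b)
    (hfst : (w.darts.map (·.fst)).Nodup) (hsnd : (w.darts.map (·.snd)).Nodup)
    (hedges : w.edges.Nodup) : ∃ M₁ M₂ : Finset (Fin n × Fin k),
      IsEdgeSetOf (M₁ ∪ M₂) w ∧ Disjoint M₁ M₂ ∧ IsEdgeMatching M₁ ∧ IsEdgeMatching M₂ := by
  classical
  -- No vertex is left twice or entered twice, which makes each direction class a matching; no edge
  -- is used twice, which makes the classes disjoint.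
  have ifst := List.inj_on_of_nodup_map hfst
  have isnd := List.inj_on_of_nodup_map hsnd
  have iedge := List.inj_on_of_nodup_map hedges
  refine ⟨Finset.univ.filter fun e => ∃ d ∈ w.darts, d.fst = Sum.inl e.1 ∧ d.snd = Sum.inr e.2,
    Finset.univ.filter fun e => ∃ d ∈ w.darts, d.fst = Sum.inr e.2 ∧ d.snd = Sum.inl e.1, ?_, ?_, ?_, ?_⟩
  · intro i j
    simp only [Finset.mem_union, Finset.mem_filter, Finset.mem_univ, true_and,
      SimpleGraph.Walk.edges, List.mem_map, SimpleGraph.dart_edge_eq_mk'_iff']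
    constructor
    · rintro (⟨d, hd, h⟩ | ⟨d, hd, h⟩)
      exacts [⟨d, hd, Or.inl h⟩, ⟨d, hd, Or.inr h⟩]
    · rintro ⟨d, hd, h | h⟩
      exacts [Or.inl ⟨d, hd, h⟩, Or.inr ⟨d, hd, h⟩]
  · rw [Finset.disjoint_left]
    rintro ⟨i, j⟩ h1 h2
    simp only [Finset.mem_filter, Finset.mem_univ, true_and] at h1 h2
    obtain ⟨d, hd, h3, h4⟩ := h1
    obtain ⟨d', hd', h5, h6⟩ := h2
    have : d = d' := iedge hd hd' (by
      rw [(SimpleGraph.dart_edge_eq_mk'_iff').2 (Or.inl ⟨h3, h4⟩),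
        (SimpleGraph.dart_edge_eq_mk'_iff').2 (Or.inr ⟨h5, h6⟩)])
    rw [← this, h3] at h5
    cases h5
  · rintro ⟨i, j⟩ h1 ⟨i', j'⟩ h2 h
    simp only [Finset.mem_filter, Finset.mem_univ, true_and] at h1 h2
    obtain ⟨d, hd, h3, h4⟩ := h1
    obtain ⟨d', hd', h5, h6⟩ := h2
    have : d = d' := by
      rcases h with h | h
      · exact ifst hd hd' (by rw [h3, h5]; exact congrArg _ h)
      · exact isnd hd hd' (by rw [h4, h6]; exact congrArg _ h)
    subst this
    rw [h3] at h5
    rw [h4] at h6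
    rw [Sum.inl_injective h5, Sum.inr_injective h6]
  · rintro ⟨i, j⟩ h1 ⟨i', j'⟩ h2 h
    simp only [Finset.mem_filter, Finset.mem_univ, true_and] at h1 h2
    obtain ⟨d, hd, h3, h4⟩ := h1
    obtain ⟨d', hd', h5, h6⟩ := h2
    have : d = d' := by
      rcases h with h | h
      · exact isnd hd hd' (by rw [h4, h6]; exact congrArg _ h)
      · exact ifst hd hd' (by rw [h3, h5]; exact congrArg _ h)
    subst this
    rw [h3] at h5
    rw [h4] at h6
    rw [Sum.inl_injective h6, Sum.inr_injective h5]

theorem exists_cycleOrMaximalPath {i : Fin n} {j : Fin k} (h : 0 < x i j ∧ x i j < 1) :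
    ∃ M₁ M₂ : Finset (Fin n × Fin k), IsCycleOrMaximalPath x (M₁ ∪ M₂) ∧ Disjoint M₁ M₂ ∧
      IsEdgeMatching M₁ ∧ IsEdgeMatching M₂ := by
  rcases exists_isCycle_or_maximal_isPath (floatingGraph_adj_inl_inr.2 h) with
    ⟨a, w, hw⟩ | ⟨a, b, w, hw, hnil, ha, hb⟩
  · obtain ⟨M₁, M₂, h1, h2⟩ := exists_matchings_of_walk w
      (by rw [w.map_fst_darts]
          exact (w.support_dropLast hw.not_nil) ▸ hw.nodup_dropLast_support)
      (by rw [w.map_snd_darts]; exact hw.support_nodup) hw.edges_nodup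
    exact ⟨M₁, M₂, Or.inl ⟨a, w, hw, h1⟩, h2⟩
  · obtain ⟨M₁, M₂, h1, h2⟩ := exists_matchings_of_walk w
      (by rw [w.map_fst_darts]; exact hw.support_nodup.sublist (List.dropLast_sublist _))
      (by rw [w.map_snd_darts]; exact hw.support_nodup.sublist (List.tail_sublist _))
      hw.edges_nodup
    exact ⟨M₁, M₂, Or.inr ⟨a, b, w, hw, hnil, h1, ha, hb⟩, h2⟩

theorem IsEdgeSetOf.floating {a b : Fin n ⊕ Fin k} {w : (floatingGraph x).Walk a b}
    (hM : IsEdgeSetOf M w) {i : Fin n} {j : Fin k} (h : (i, j) ∈ M) : 0 < x i j ∧ x i j < 1 :=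
  floatingGraph_adj_inl_inr.1 (w.adj_of_mem_edges ((hM i j).1 h))

theorem IsEdgeSetOf.nonempty {a b : Fin n ⊕ Fin k} {w : (floatingGraph x).Walk a b}
    (hM : IsEdgeSetOf M w) (hw : ¬ w.Nil) : M.Nonempty := by
  cases w with
  | nil => exact absurd SimpleGraph.Walk.Nil.nil hw
  | cons hadj q =>
    obtain ⟨i, j, -, ⟨rfl, rfl⟩ | ⟨rfl, rfl⟩⟩ := floatingGraph_adj_iff.1 hadj
    · exact ⟨(i, j), (hM i j).2 (by simp)⟩
    · exact ⟨(i, j), (hM i j).2 (by simp [Sym2.eq_swap])⟩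

theorem IsCycleOrMaximalPath.floating (hM : IsCycleOrMaximalPath x M) {i : Fin n} {j : Fin k}
    (h : (i, j) ∈ M) : 0 < x i j ∧ x i j < 1 := by
  obtain ⟨a, w, -, hs⟩ | ⟨a, b, w, -, -, hs, -⟩ := hM <;> exact hs.floating h

theorem IsCycleOrMaximalPath.nonempty (hM : IsCycleOrMaximalPath x M) : M.Nonempty := by
  obtain ⟨a, w, hw, hs⟩ | ⟨a, b, w, -, hnil, hs, -⟩ := hM
  exacts [hs.nonempty hw.not_nil, hs.nonempty hnil]

/-- At a vertex with exactly one edge of the cycle or maximal path, every floating edge belongs to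
it. -/
theorem IsCycleOrMaximalPath.mem_edges_of_unique (hM : IsCycleOrMaximalPath x M) :
    ∃ (E : Set (Sym2 (Fin n ⊕ Fin k))), (∀ i j, (i, j) ∈ M ↔ s(Sum.inl i, Sum.inr j) ∈ E) ∧
      (∀ e ∈ E, e ∈ (floatingGraph x).edgeSet) ∧
      ∀ v z, s(v, z) ∈ E → (∀ z', s(v, z') ∈ E → z' = z) →
        ∀ c, (floatingGraph x).Adj v c → s(v, c) ∈ E := by
  obtain ⟨a, w, hw, hs⟩ | ⟨a, b, w, hw, -, hs, ha, hb⟩ := hM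
  · refine ⟨{e | e ∈ w.edges}, hs, fun e he => w.edges_subset_edgeSet he, fun v z hz hu => ?_⟩
    -- A vertex on a cycle always has a second cycle edge, so the uniqueness assumption is
    -- contradictory.
    obtain ⟨z', hne, hz'⟩ := exists_mem_edges_ne_of_isCycle hw hz
    exact absurd (hu z' hz') hne
  · refine ⟨{e | e ∈ w.edges}, hs, fun e he => w.edges_subset_edgeSet he, fun v z hz hu => ?_⟩
    by_cases hva : v = a
    · subst hva; exact ha
    by_cases hvb : v = b
    · subst hvb; exact hb
    obtain ⟨z', hne, hz'⟩ := exists_mem_edges_ne_of_isPath hw hva hvb hz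
    exact absurd (hu z' hz') hne

/-- Used for integrality: where only one entry of a row is moved, all its other entries are already
`0` or `1`. -/
theorem IsCycleOrMaximalPath.eq_of_floating_left (hM : IsCycleOrMaximalPath x M) {i : Fin n}
    {j : Fin k} (h : (i, j) ∈ M) (hu : ∀ j', (i, j') ∈ M → j' = j) {j' : Fin k}
    (h0 : 0 < x i j') (h1 : x i j' < 1) : j' = j := by
  obtain ⟨E, hE, hG, hend⟩ := hM.mem_edges_of_unique
  refine hu j' ((hE i j').2 (hend _ _ ((hE i j).1 h) (fun z' hz' => ?_) _
    (floatingGraph_adj_inl_inr.2 ⟨h0, h1⟩)))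
  obtain ⟨i₁, j₁, -, ⟨e1, e2⟩ | ⟨e1, e2⟩⟩ := floatingGraph_adj_iff.1 (hG _ hz')
  · cases e1
    subst e2
    rw [hu j₁ ((hE i j₁).2 hz')]
  · cases e1

theorem IsCycleOrMaximalPath.eq_of_floating_right (hM : IsCycleOrMaximalPath x M) {i : Fin n}
    {j : Fin k} (h : (i, j) ∈ M) (hu : ∀ i', (i', j) ∈ M → i' = i) {i' : Fin n}
    (h0 : 0 < x i' j) (h1 : x i' j < 1) : i' = i := by
  obtain ⟨E, hE, hG, hend⟩ := hM.mem_edges_of_unique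
  refine hu i' ((hE i' j).2 (Sym2.eq_swap ▸ hend _ _ (Sym2.eq_swap ▸ (hE i j).1 h)
    (fun z' hz' => ?_) _ (floatingGraph_adj_inl_inr.2 ⟨h0, h1⟩).symm))
  obtain ⟨i₁, j₁, -, ⟨e1, e2⟩ | ⟨e1, e2⟩⟩ := floatingGraph_adj_iff.1 (hG _ hz')
  · cases e1
  · cases e1
    subst e2
    rw [hu i₁ ((hE i₁ j).2 (Sym2.eq_swap ▸ hz'))]

/-- The candidate step sizes are among the finitely many numbers `1 - x e` and `x e`, so a least one
exists. -/
theorem exists_isStepSize (hne : (M₁ ∪ M₂).Nonempty)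
    (hfl : ∀ e ∈ M₁ ∪ M₂, 0 < x e.1 e.2 ∧ x e.1 e.2 < 1) : ∃ γ, IsStepSize x M₁ M₂ γ := by
  classical
  set s : Set ℝ := {γ : ℝ | 0 < γ ∧
    ((∃ e ∈ M₁, x e.1 e.2 + γ = 1) ∨ (∃ e ∈ M₂, x e.1 e.2 - γ = 0))}
  have hfin : s.Finite := by
    refine ((M₁.image fun e => 1 - x e.1 e.2) ∪ (M₂.image fun e => x e.1 e.2)).finite_toSet.subset ?_
    rintro γ ⟨-, ⟨e, he, h⟩ | ⟨e, he, h⟩⟩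
    · exact Finset.mem_coe.2 (Finset.mem_union_left _
        (Finset.mem_image.2 ⟨e, he, by linarith⟩))
    · exact Finset.mem_coe.2 (Finset.mem_union_right _
        (Finset.mem_image.2 ⟨e, he, by linarith⟩))
  have hs : s.Nonempty := by
    obtain ⟨e, he⟩ := hne
    have h := hfl e he
    rcases Finset.mem_union.1 he with h1 | h1
    · exact ⟨1 - x e.1 e.2, by linarith, Or.inl ⟨e, h1, by ring⟩⟩
    · exact ⟨x e.1 e.2, by linarith, Or.inr ⟨e, h1, by ring⟩⟩
  obtain ⟨γ, h1, h2⟩ := s.exists_min_image id hfin hs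
  exact ⟨γ, h1, h2⟩

theorem IsStepSize.pos (h : IsStepSize x M₁ M₂ γ) : 0 < γ := h.1.1

theorem IsStepSize.le_one_sub (h : IsStepSize x M₁ M₂ γ) {i : Fin n} {j : Fin k}
    (he : (i, j) ∈ M₁) (hx : x i j < 1) : γ ≤ 1 - x i j :=
  h.2 ⟨by linarith, Or.inl ⟨(i, j), he, by ring⟩⟩

theorem IsStepSize.le_self (h : IsStepSize x M₁ M₂ γ) {i : Fin n} {j : Fin k}
    (he : (i, j) ∈ M₂) (hx : 0 < x i j) : γ ≤ x i j :=
  h.2 ⟨hx, Or.inr ⟨(i, j), he, by ring⟩⟩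

theorem shift_of_mem_left (hd : Disjoint M₁ M₂) {i : Fin n} {j : Fin k} (h : (i, j) ∈ M₁) :
    shift x M₁ M₂ γ i j = x i j + γ := by
  have h' := Finset.disjoint_left.1 hd h
  simp [shift, h, h']

theorem shift_of_mem_right (hd : Disjoint M₁ M₂) {i : Fin n} {j : Fin k} (h : (i, j) ∈ M₂) :
    shift x M₁ M₂ γ i j = x i j - γ := by
  have h' := Finset.disjoint_right.1 hd h
  simp [shift, h, h']

theorem shift_of_notMem {i : Fin n} {j : Fin k} (h1 : (i, j) ∉ M₁) (h2 : (i, j) ∉ M₂) :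
    shift x M₁ M₂ γ i j = x i j := by
  simp [shift, h1, h2]

theorem IsStepSize.shift_mem (h : IsStepSize x M₁ M₂ γ) (hd : Disjoint M₁ M₂)
    (hfl : ∀ e ∈ M₁ ∪ M₂, 0 < x e.1 e.2 ∧ x e.1 e.2 < 1)
    (hx : ∀ i j, 0 ≤ x i j ∧ x i j ≤ 1) (i : Fin n) (j : Fin k) :
    0 ≤ shift x M₁ M₂ γ i j ∧ shift x M₁ M₂ γ i j ≤ 1 := by
  have hpos := h.pos
  by_cases h1 : (i, j) ∈ M₁
  · have h3 := hfl _ (Finset.mem_union_left _ h1)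
    have h4 := h.le_one_sub h1 h3.2
    rw [shift_of_mem_left hd h1]
    constructor <;> linarith [h3.1]
  by_cases h2 : (i, j) ∈ M₂
  · have h3 := hfl _ (Finset.mem_union_right _ h2)
    have h4 := h.le_self h2 h3.1
    rw [shift_of_mem_right hd h2]
    constructor <;> linarith [h3.2]
  rw [shift_of_notMem h1 h2]
  exact hx i j

open Classical in
/-- The number of floating edges. -/
noncomputable def floatingCard (x : Fin n → Fin k → ℝ) : ℕ :=
  (Finset.univ.filter fun e : Fin n × Fin k => 0 < x e.1 e.2 ∧ x e.1 e.2 < 1).card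

/-- Termination measure: entries off the cycle or path do not move, and the edge that attains the
step size stops floating. -/
theorem IsStepSize.floatingCard_shift_lt (h : IsStepSize x M₁ M₂ γ) (hd : Disjoint M₁ M₂)
    (hfl : ∀ e ∈ M₁ ∪ M₂, 0 < x e.1 e.2 ∧ x e.1 e.2 < 1) :
    floatingCard (shift x M₁ M₂ γ) < floatingCard x := by
  classical
  refine Finset.card_lt_card (Finset.ssubset_iff_subset_ne.2 ⟨fun e he => ?_, fun heq => ?_⟩)
  · simp only [Finset.mem_filter, Finset.mem_univ, true_and] at he ⊢
    by_cases h1 : (e.1, e.2) ∈ M₁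
    · exact hfl _ (Finset.mem_union_left _ h1)
    by_cases h2 : (e.1, e.2) ∈ M₂
    · exact hfl _ (Finset.mem_union_right _ h2)
    rwa [shift_of_notMem h1 h2] at he
  · obtain ⟨e, he, hγ⟩ | ⟨e, he, hγ⟩ := h.1.2
    · have h1 := hfl e (Finset.mem_union_left _ he)
      have h2 : e ∈ Finset.univ.filter fun e : Fin n × Fin k => 0 < x e.1 e.2 ∧ x e.1 e.2 < 1 := by
        simpa using h1
      rw [← heq] at h2
      simp only [Finset.mem_filter, Finset.mem_univ, true_and] at h2
      rw [shift_of_mem_left hd he, hγ] at h2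
      exact lt_irrefl _ h2.2
    · have h1 := hfl e (Finset.mem_union_right _ he)
      have h2 : e ∈ Finset.univ.filter fun e : Fin n × Fin k => 0 < x e.1 e.2 ∧ x e.1 e.2 < 1 := by
        simpa using h1
      rw [← heq] at h2
      simp only [Finset.mem_filter, Finset.mem_univ, true_and] at h2
      rw [shift_of_mem_right hd he, hγ] at h2
      exact lt_irrefl _ h2.1

theorem PMF.exists_mix {α : Type*} [Fintype α] (μ₁ μ₂ : PMF α) {s t : ℝ} (hs : 0 ≤ s) (ht : 0 ≤ t)
    (hst : s + t = 1) :
    ∃ μ : PMF α, ∀ a, (μ a).toReal = s * (μ₁ a).toReal + t * (μ₂ a).toReal := by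
  have hnn : ∀ a, 0 ≤ s * (μ₁ a).toReal + t * (μ₂ a).toReal := fun a =>
    add_nonneg (mul_nonneg hs ENNReal.toReal_nonneg) (mul_nonneg ht ENNReal.toReal_nonneg)
  refine ⟨PMF.ofFintype (fun a => ENNReal.ofReal (s * (μ₁ a).toReal + t * (μ₂ a).toReal)) ?_,
    fun a => ?_⟩
  · rw [← ENNReal.ofReal_sum_of_nonneg fun a _ => hnn a, Finset.sum_add_distrib, ← Finset.mul_sum,
      ← Finset.mul_sum, PMF.sum_toReal, PMF.sum_toReal, mul_one, mul_one, hst, ENNReal.ofReal_one]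
  · rw [PMF.ofFintype_apply, ENNReal.toReal_ofReal (hnn a)]

/-- From weights in `[0, 1]` the dependent rounding scheme can be run to completion. -/
theorem exists_gkps (x : Fin n → Fin k → ℝ) (hx : ∀ i j, 0 ≤ x i j ∧ x i j ≤ 1) :
    ∃ μ, GKPS x μ := by
  induction hm : floatingCard x using Nat.strong_induction_on generalizing x with
  | _ m ih =>
    by_cases hf : ∃ i j, 0 < x i j ∧ x i j < 1
    · obtain ⟨i, j, hij⟩ := hf
      obtain ⟨M₁, M₂, hP, hd, h1, h2⟩ := exists_cycleOrMaximalPath hij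
      have hfl : ∀ e ∈ M₁ ∪ M₂, 0 < x e.1 e.2 ∧ x e.1 e.2 < 1 := fun e he => hP.floating he
      have hfl' : ∀ e ∈ M₂ ∪ M₁, 0 < x e.1 e.2 ∧ x e.1 e.2 < 1 := by
        rwa [Finset.union_comm]
      obtain ⟨α, hα⟩ := exists_isStepSize hP.nonempty hfl
      obtain ⟨β, hβ⟩ := exists_isStepSize (M₁ := M₂) (M₂ := M₁)
        (by rw [Finset.union_comm]; exact hP.nonempty) hfl'
      obtain ⟨μ₁, hμ₁⟩ := ih _ (hm ▸ hα.floatingCard_shift_lt hd hfl) _ (hα.shift_mem hd hfl hx) rfl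
      obtain ⟨μ₂, hμ₂⟩ := ih _ (hm ▸ hβ.floatingCard_shift_lt hd.symm hfl') _
        (hβ.shift_mem hd.symm hfl' hx) rfl
      have hα0 := hα.pos
      have hβ0 := hβ.pos
      obtain ⟨μ, hμ⟩ := PMF.exists_mix μ₁ μ₂ (s := β / (α + β)) (t := α / (α + β))
        (by positivity) (by positivity) (by field_simp; ring)
      exact ⟨μ, GKPS.step x M₁ M₂ α β μ₁ μ₂ μ hP hd h1 h2 hα hβ hμ₁ hμ₂ hμ⟩
    · push Not at hf
      -- Without floating entries every weight is `0` or `1`, and the positive ones are exactly the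
      -- ones equal to `1`.
      refine ⟨_, GKPS.done x (fun i j => decide (0 < x i j)) fun i j => ?_⟩
      rcases (hx i j).1.lt_or_eq with h | h
      · simp [le_antisymm (hx i j).2 (hf i j h)]
      · simp [← h]

end Rounding

/-! ### The algorithm can be carried out -/

namespace ParInstance

theorem nonempty_algPar (I : ParInstance) : Nonempty I.AlgPar := by
  classical
  obtain ⟨y, hy⟩ := I.exists_lpOptimal
  obtain ⟨μ, hμ⟩ := exists_gkps y fun i j => ⟨hy.1.nonneg i j, hy.1.le_one i j⟩
  refine ⟨⟨y, hy, μ, hμ, fun Y j => (Finset.univ.filter fun i => Y i j = true).toList.mergeSort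
    fun a b => decide (I.v b j ≤ I.v a j), fun Y j => ?_, fun Y j i => ?_, fun Y j => ?_⟩⟩
  · exact (List.mergeSort_perm _ _).nodup_iff.2 (Finset.nodup_toList _)
  · rw [List.mem_mergeSort]
    simp
  · have h := List.pairwise_mergeSort (le := fun a b => decide (I.v b j ≤ I.v a j))
      (fun a b c h1 h2 => by
        simp only [decide_eq_true_eq] at h1 h2 ⊢
        exact h2.trans h1)
      (fun a b => by
        simp only [Bool.or_eq_true, decide_eq_true_eq]
        exact le_total _ _) (Finset.univ.filter fun i => Y i j = true).toList
    simpa using h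

end ParInstance

/-! ## Properties of the dependent rounding scheme -/

section OneVertex

variable {ι : Type*} {A B : ι → Prop}

open Classical in
-- `A` and `B` mark the raised and lowered edges at one vertex. If both occur, the raise is
-- compensated. If only a raise occurs, the raised entry is the only fractional one, so the others
-- sum to an integer `m`; then `m < T` forces `m + 1 ≤ T`, which leaves room for an entry of size at
-- most `1`.
theorem sum_shift_le [Fintype ι] (f : ι → ℝ) {γ : ℝ} (hγ : 0 ≤ γ) (T : ℕ)
    (hA : ∀ a a', A a → A a' → a = a') (hf : ∑ i, f i ≤ T)
    (hfl : ∀ a, A a → (∀ i, ¬ B i) → 0 < f a ∧ f a + γ ≤ 1 ∧ ∀ i, i ≠ a → f i = 0 ∨ f i = 1) :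
    ∑ i, (f i + (if A i then γ else 0) - (if B i then γ else 0)) ≤ T := by
  rw [Finset.sum_sub_distrib, Finset.sum_add_distrib]
  have hB0 : 0 ≤ ∑ i, if B i then γ else 0 :=
    Finset.sum_nonneg fun i _ => by split_ifs <;> simp [hγ]
  by_cases ha : ∃ a, A a
  · obtain ⟨a, ha⟩ := ha
    have hsA : ∑ i, (if A i then γ else 0) = γ := by
      rw [Finset.sum_eq_single a (fun i _ hi => if_neg fun h => hi (hA _ _ h ha))
        (fun h => absurd (Finset.mem_univ a) h), if_pos ha]
    by_cases hb : ∃ b, B b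
    · obtain ⟨b, hb⟩ := hb
      have hsB : γ ≤ ∑ i, if B i then γ else 0 := by
        refine le_trans (by rw [if_pos hb]) (Finset.single_le_sum
          (f := fun i => if B i then γ else 0)
          (fun i _ => by split_ifs <;> simp [hγ]) (Finset.mem_univ b))
      linarith
    · push Not at hb
      obtain ⟨h0, h1, h2⟩ := hfl a ha hb
      have hm : ∃ m : ℕ, ∑ i ∈ Finset.univ.erase a, f i = m := by
        refine ⟨∑ i ∈ Finset.univ.erase a, if f i = 0 then 0 else 1, ?_⟩
        push_cast
        refine Finset.sum_congr rfl fun i hi => ?_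
        rcases h2 i (Finset.ne_of_mem_erase hi) with h | h <;> simp [h]
      obtain ⟨m, hm⟩ := hm
      rw [← Finset.add_sum_erase _ _ (Finset.mem_univ a), hm] at hf ⊢
      have hlt : (m : ℝ) < T := by linarith
      have hle : (m : ℝ) + 1 ≤ T := by exact_mod_cast hlt
      linarith
  · push Not at ha
    simp only [ha, if_false, Finset.sum_const_zero]
    linarith

/-- A matching has at most one edge at a vertex, so the product has at most one factor. -/
theorem exists_prod_eq_affine (s : Finset ι) (hA : ∀ a ∈ s, ∀ a' ∈ s, a = a') (g c : ι → ℝ)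
    (hc : ∀ i, 0 ≤ c i) : ∃ u p : ℝ, 0 ≤ p ∧ ∀ γ, ∏ i ∈ s, (g i + c i * γ) = u + p * γ := by
  rcases s.eq_empty_or_nonempty with rfl | ⟨a, ha⟩
  · exact ⟨1, 0, le_rfl, fun γ => by simp⟩
  · have : s = {a} := Finset.eq_singleton_iff_unique_mem.2 ⟨ha, fun i hi => hA _ hi _ ha⟩
    subst this
    exact ⟨g a, c a, hc a, fun γ => by simp⟩

open Classical in
/-- Moving two factors in opposite directions by a centered amount decreases the expected product. -/
theorem mix_prod_shift_le (s : Finset ι) (f c : ι → ℝ) (hc : ∀ i, 0 ≤ c i)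
    (hcf : ∀ i, 0 ≤ 1 - c i * f i)
    (hA : ∀ a a', A a → A a' → a = a') (hB : ∀ a a', B a → B a' → a = a')
    (hAB : ∀ i, A i → ¬ B i) {α β : ℝ} (hα : 0 < α) (hβ : 0 < β) :
    β / (α + β) * ∏ i ∈ s, (1 - c i * (f i + (if A i then α else 0) - (if B i then α else 0))) +
      α / (α + β) * ∏ i ∈ s, (1 - c i * (f i + (if B i then β else 0) - (if A i then β else 0))) ≤
      ∏ i ∈ s, (1 - c i * f i) := by
  obtain ⟨u, p, hp, hu⟩ := exists_prod_eq_affine (s.filter A)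
    (fun a ha a' ha' => hA _ _ (Finset.mem_filter.1 ha).2 (Finset.mem_filter.1 ha').2)
    (fun i => 1 - c i * f i) c hc
  obtain ⟨v, q, hq, hv⟩ := exists_prod_eq_affine ((s.filter fun i => ¬ A i).filter B)
    (fun a ha a' ha' => hB _ _ (Finset.mem_filter.1 ha).2 (Finset.mem_filter.1 ha').2)
    (fun i => 1 - c i * f i) c hc
  set P := ∏ i ∈ (s.filter fun i => ¬ A i).filter (fun i => ¬ B i), (1 - c i * f i)
  have hP : 0 ≤ P := Finset.prod_nonneg fun i _ => hcf i
  have key : ∀ γ, ∏ i ∈ s, (1 - c i * (f i + (if A i then γ else 0) - (if B i then γ else 0))) =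
      (u - p * γ) * ((v + q * γ) * P) := by
    intro γ
    rw [← Finset.prod_filter_mul_prod_filter_not s A,
      ← Finset.prod_filter_mul_prod_filter_not (s.filter fun i => ¬ A i) B]
    congr 1
    · rw [sub_eq_add_neg, ← mul_neg, ← hu]
      refine Finset.prod_congr rfl fun i hi => ?_
      have hi := (Finset.mem_filter.1 hi).2
      simp only [hi, hAB i hi, if_true, if_false]
      ring
    congr 1
    · rw [← hv]
      refine Finset.prod_congr rfl fun i hi => ?_
      have h1 := (Finset.mem_filter.1 hi).2
      have h2 := (Finset.mem_filter.1 (Finset.mem_filter.1 hi).1).2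
      simp only [h1, h2, if_true, if_false]
      ring
    · refine Finset.prod_congr rfl fun i hi => ?_
      have h1 := (Finset.mem_filter.1 hi).2
      have h2 := (Finset.mem_filter.1 (Finset.mem_filter.1 hi).1).2
      simp only [h1, h2, if_false]
      ring
  -- The opposite move is the same formula at `γ = -β`.
  have h2 : ∏ i ∈ s, (1 - c i * (f i + (if B i then β else 0) - (if A i then β else 0))) =
      (u - p * -β) * ((v + q * -β) * P) := by
    rw [← key]
    refine Finset.prod_congr rfl fun i _ => ?_
    split_ifs <;> ring
  have h3 : ∏ i ∈ s, (1 - c i * f i) = u * (v * P) := by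
    have := key 0
    simpa using this
  rw [key, h2, h3]
  -- The move has mean zero, so the linear terms cancel. The quadratic term survives with
  -- coefficient `-p * q`, and the mean square of the move is `α * β`.
  have h4 : u * (v * P) - (β / (α + β) * ((u - p * α) * ((v + q * α) * P)) +
      α / (α + β) * ((u - p * -β) * ((v + q * -β) * P))) = p * q * P * (α * β) := by
    field_simp
    ring
  have h5 : 0 ≤ p * q * P * (α * β) := by positivity
  linarith

end OneVertex

section Rounding

variable {n k : ℕ} {x : Fin n → Fin k → ℝ} {M₁ M₂ : Finset (Fin n × Fin k)} {γ : ℝ}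

theorem zero_or_one_of_not_floating {i : Fin n} {j : Fin k} (hx : 0 ≤ x i j ∧ x i j ≤ 1)
    (h : ¬ (0 < x i j ∧ x i j < 1)) : x i j = 0 ∨ x i j = 1 := by
  rcases hx.1.lt_or_eq with h0 | h0
  · exact Or.inr (le_antisymm hx.2 (not_lt.1 fun h1 => h ⟨h0, h1⟩))
  · exact Or.inl h0.symm

theorem IsStepSize.sum_shift_right_le (hγ : IsStepSize x M₁ M₂ γ)
    (hP : IsCycleOrMaximalPath x (M₁ ∪ M₂)) (hM₁ : IsEdgeMatching M₁)
    (hx : ∀ i j, 0 ≤ x i j ∧ x i j ≤ 1) (T : ℕ) (j : Fin k) (hT : ∑ i, x i j ≤ T) :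
    ∑ i, shift x M₁ M₂ γ i j ≤ T := by
  classical
  have h := sum_shift_le (A := fun i => (i, j) ∈ M₁) (B := fun i => (i, j) ∈ M₂) (fun i => x i j)
    hγ.pos.le T (fun a a' ha ha' => congrArg Prod.fst (hM₁ _ ha _ ha' (Or.inr rfl))) hT
    (fun a ha hB => by
      have ha' : (a, j) ∈ M₁ ∪ M₂ := Finset.mem_union_left _ ha
      have hfl := hP.floating ha'
      refine ⟨hfl.1, by linarith [hγ.le_one_sub ha hfl.2], fun i hi => ?_⟩
      refine zero_or_one_of_not_floating (hx i j) fun hij => hi ?_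
      refine hP.eq_of_floating_right ha' (fun i' hi' => ?_) hij.1 hij.2
      exact congrArg Prod.fst (hM₁ _ ((Finset.mem_union.1 hi').resolve_right (hB i')) _ ha
        (Or.inr rfl)))
  convert h using 1
  exact Finset.sum_congr rfl fun i _ => by simp only [shift]; congr

theorem IsStepSize.sum_shift_left_le (hγ : IsStepSize x M₁ M₂ γ)
    (hP : IsCycleOrMaximalPath x (M₁ ∪ M₂)) (hM₁ : IsEdgeMatching M₁)
    (hx : ∀ i j, 0 ≤ x i j ∧ x i j ≤ 1) (T : ℕ) (i : Fin n) (hT : ∑ j, x i j ≤ T) :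
    ∑ j, shift x M₁ M₂ γ i j ≤ T := by
  classical
  have h := sum_shift_le (A := fun j => (i, j) ∈ M₁) (B := fun j => (i, j) ∈ M₂) (fun j => x i j)
    hγ.pos.le T (fun a a' ha ha' => congrArg Prod.snd (hM₁ _ ha _ ha' (Or.inl rfl))) hT
    (fun a ha hB => by
      have ha' : (i, a) ∈ M₁ ∪ M₂ := Finset.mem_union_left _ ha
      have hfl := hP.floating ha'
      refine ⟨hfl.1, by linarith [hγ.le_one_sub ha hfl.2], fun j hj => ?_⟩
      refine zero_or_one_of_not_floating (hx i j) fun hij => hj ?_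
      refine hP.eq_of_floating_left ha' (fun j' hj' => ?_) hij.1 hij.2
      exact congrArg Prod.snd (hM₁ _ ((Finset.mem_union.1 hj').resolve_right (hB j')) _ ha
        (Or.inl rfl)))
  convert h using 1
  exact Finset.sum_congr rfl fun j _ => by simp only [shift]; congr

/-- The rounding respects integral bounds on the degrees. -/
theorem GKPS.degree_le {μ : PMF (Fin n → Fin k → Bool)} (h : GKPS x μ)
    (hx : ∀ i j, 0 ≤ x i j ∧ x i j ≤ 1) (R C : ℕ) (hR : ∀ i, ∑ j, x i j ≤ R)
    (hC : ∀ j, ∑ i, x i j ≤ C) (Y : Fin n → Fin k → Bool) (hY : (μ Y).toReal ≠ 0) :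
    (∀ i, ∑ j, (if Y i j = true then (1 : ℝ) else 0) ≤ R) ∧
      ∀ j, ∑ i, (if Y i j = true then (1 : ℝ) else 0) ≤ C := by
  induction h with
  | done x Y₀ hY₀ =>
    have : Y = Y₀ := by
      by_contra hne
      exact hY (by simp [PMF.pure_apply, hne])
    subst this
    simpa only [hY₀] using And.intro hR hC
  | step x M₁ M₂ α β μ₁ μ₂ μ hP hd hM₁ hM₂ hα hβ _ _ hμ ih₁ ih₂ =>
    have hP' : IsCycleOrMaximalPath x (M₂ ∪ M₁) := by rwa [Finset.union_comm]
    by_cases h₁ : (μ₁ Y).toReal = 0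
    · by_cases h₂ : (μ₂ Y).toReal = 0
      · exact absurd (by rw [hμ, h₁, h₂]; ring) hY
      · exact ih₂ (hβ.shift_mem hd.symm (fun e he => hP'.floating he) hx)
          (fun i => hβ.sum_shift_left_le hP' hM₂ hx R i (hR i))
          (fun j => hβ.sum_shift_right_le hP' hM₂ hx C j (hC j)) h₂
    · exact ih₁ (hα.shift_mem hd (fun e he => hP.floating he) hx)
          (fun i => hα.sum_shift_left_le hP hM₁ hx R i (hR i))
          (fun j => hα.sum_shift_right_le hP hM₁ hx C j (hC j)) h₁

/-- Negative correlation of the edges at a vertex. -/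
theorem GKPS.sum_prod_le {μ : PMF (Fin n → Fin k → Bool)} (h : GKPS x μ)
    (hx : ∀ i j, 0 ≤ x i j ∧ x i j ≤ 1) (j : Fin k) (s : Finset (Fin n)) (c : Fin n → ℝ)
    (hc : ∀ i, 0 ≤ c i ∧ c i ≤ 1) :
    ∑ Y, (μ Y).toReal * ∏ i ∈ s, (1 - c i * (if Y i j = true then 1 else 0)) ≤
      ∏ i ∈ s, (1 - c i * x i j) := by
  classical
  induction h with
  | done x Y₀ hY₀ =>
    rw [Finset.sum_eq_single Y₀ (fun Y _ hne => by simp [PMF.pure_apply, hne])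
      (fun h => absurd (Finset.mem_univ _) h)]
    simp [hY₀]
  | step x M₁ M₂ α β μ₁ μ₂ μ hP hd hM₁ hM₂ hα hβ _ _ hμ ih₁ ih₂ =>
    have hP' : IsCycleOrMaximalPath x (M₂ ∪ M₁) := by rwa [Finset.union_comm]
    have i₁ := ih₁ (hα.shift_mem hd (fun e he => hP.floating he) hx)
    have i₂ := ih₂ (hβ.shift_mem hd.symm (fun e he => hP'.floating he) hx)
    have hα0 := hα.pos
    have hβ0 := hβ.pos
    have hmix := mix_prod_shift_le (A := fun i => (i, j) ∈ M₁) (B := fun i => (i, j) ∈ M₂) s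
      (fun i => x i j) c (fun i => (hc i).1)
      (fun i => sub_nonneg.2 (mul_le_one₀ (hc i).2 (hx i j).1 (hx i j).2))
      (fun a a' ha ha' => congrArg Prod.fst (hM₁ _ ha _ ha' (Or.inr rfl)))
      (fun a a' ha ha' => congrArg Prod.fst (hM₂ _ ha _ ha' (Or.inr rfl)))
      (fun i hi => Finset.disjoint_left.1 hd hi) hα0 hβ0
    have j₁ := mul_le_mul_of_nonneg_left i₁ (show 0 ≤ β / (α + β) by positivity)
    have j₂ := mul_le_mul_of_nonneg_left i₂ (show 0 ≤ α / (α + β) by positivity)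
    -- The expectation under `μ` is the mixture of the expectations after the two moves.
    have hsum : ∀ G : (Fin n → Fin k → Bool) → ℝ, ∑ Y, (μ Y).toReal * G Y =
        β / (α + β) * ∑ Y, (μ₁ Y).toReal * G Y + α / (α + β) * ∑ Y, (μ₂ Y).toReal * G Y := by
      intro G
      rw [Finset.mul_sum, Finset.mul_sum, ← Finset.sum_add_distrib]
      exact Finset.sum_congr rfl fun Y _ => by rw [hμ]; ring
    rw [hsum]
    refine (add_le_add j₁ j₂).trans (le_trans (le_of_eq ?_) hmix)
    congr 2 <;>
    · exact Finset.prod_congr rfl fun i _ => by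
        simp only [shift]; congr

end Rounding

/-! ## Decomposition of values into layers -/

/-- `c τ` is the gap between `τ` and the preceding element of `A` (or `0`), so the gaps up to `a`
telescope to `a`. The bound on the total is carried along to keep the gap of a new maximum
nonnegative. -/
theorem exists_layers (A : Finset ℝ) (hA : ∀ a ∈ A, 0 ≤ a) : ∃ c : ℝ → ℝ, (∀ τ, 0 ≤ c τ) ∧
    (∀ b, 0 ≤ b → (∀ a ∈ A, a ≤ b) → ∑ τ ∈ A, c τ ≤ b) ∧
    ∀ a ∈ A, a = ∑ τ ∈ A, c τ * (if τ ≤ a then 1 else 0) := by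
  induction A using Finset.induction_on_max with
  | empty => exact ⟨0, by simp, by simp, by simp⟩
  | insert m A hm ih =>
    obtain ⟨c, hc0, hcb, hca⟩ := ih fun a ha => hA a (Finset.mem_insert_of_mem ha)
    have hmA : m ∉ A := fun h => lt_irrefl _ (hm m h)
    have hle : ∑ τ ∈ A, c τ ≤ m :=
      hcb m (hA m (Finset.mem_insert_self _ _)) fun a ha => (hm a ha).le
    have hne : ∀ τ ∈ A, Function.update c m (m - ∑ τ ∈ A, c τ) τ = c τ := fun τ hτ =>
      Function.update_of_ne (hm τ hτ).ne _ _
    refine ⟨Function.update c m (m - ∑ τ ∈ A, c τ), fun τ => ?_, fun b _ hab => ?_,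
      fun a ha => ?_⟩
    · rcases eq_or_ne τ m with rfl | h
      · rw [Function.update_self]; linarith
      · rw [Function.update_of_ne h]; exact hc0 τ
    · rw [Finset.sum_insert hmA, Function.update_self, Finset.sum_congr rfl hne]
      linarith [hab m (Finset.mem_insert_self _ _)]
    · have hsum : ∑ τ ∈ A, Function.update c m (m - ∑ τ ∈ A, c τ) τ * (if τ ≤ a then 1 else 0) =
          ∑ τ ∈ A, c τ * (if τ ≤ a then 1 else 0) :=
        Finset.sum_congr rfl fun τ hτ => by rw [hne τ hτ]
      rw [Finset.sum_insert hmA, Function.update_self, hsum]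
      rcases Finset.mem_insert.1 ha with rfl | ha
      · have hall : ∑ τ ∈ A, c τ * (if τ ≤ a then 1 else 0) = ∑ τ ∈ A, c τ :=
          Finset.sum_congr rfl fun τ hτ => by rw [if_pos (hm τ hτ).le, mul_one]
        rw [if_pos le_rfl, hall]
        ring
      · rw [if_neg (not_le.2 (hm a ha)), mul_zero, zero_add]
        exact hca a ha

/-- Value of the first element of a list that accepts. -/
def firstValue {α : Type*} (v : α → ℝ) (a : α → Bool) : List α → ℝ
  | [] => 0
  | i :: l => if a i = true then v i else firstValue v a l

/-- In a list of decreasing values the first acceptor has the largest value among the acceptors. Her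
value reaches `τ` exactly when some listed candidate of value at least `τ` accepts, which is when
the product vanishes. -/
theorem firstValue_eq_sum_layers {α : Type*} [Fintype α] [DecidableEq α] (v : α → ℝ) (a : α → Bool) (A : Finset ℝ)
    (c : ℝ → ℝ) (hv : ∀ i, v i = ∑ τ ∈ A, c τ * (if τ ≤ v i then 1 else 0)) (l : List α)
    (hl : l.Pairwise fun i i' => v i' ≤ v i) :
    firstValue v a l = ∑ τ ∈ A, c τ * (1 - ∏ i ∈ Finset.univ.filter (fun i => τ ≤ v i),
      (1 - (if i ∈ l then 1 else 0) * (if a i = true then 1 else 0))) := by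
  induction l with
  | nil => simp [firstValue]
  | cons i l ih =>
    rw [List.pairwise_cons] at hl
    by_cases hi : a i = true
    · rw [firstValue, if_pos hi, hv i]
      refine Finset.sum_congr rfl fun τ _ => ?_
      congr 1
      by_cases hτ : τ ≤ v i
      · rw [if_pos hτ, Finset.prod_eq_zero (i := i) (by simpa using hτ) (by simp [hi]), sub_zero]
      · rw [if_neg hτ, Finset.prod_eq_one fun i' hi' => ?_, sub_self]
        have h : i' ∉ i :: l := by
          intro hmem
          have h1 : τ ≤ v i' := by simpa using hi'
          rcases List.mem_cons.1 hmem with rfl | h2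
          · exact hτ h1
          · exact hτ (h1.trans (hl.1 i' h2))
        rw [if_neg h, zero_mul, sub_zero]
    · rw [firstValue, if_neg hi, ih hl.2]
      refine Finset.sum_congr rfl fun τ _ => ?_
      congr 2
      refine Finset.prod_congr rfl fun i' _ => ?_
      rcases eq_or_ne i' i with rfl | hne
      · simp [hi]
      · simp [hne]

/-- By convexity of `exp`, the concave function `1 - exp (-s)` lies above its chord on `[0, 1]`. -/
theorem one_sub_exp_neg_ge {s : ℝ} (h0 : 0 ≤ s) (h1 : s ≤ 1) :
    (1 - 1 / Real.exp 1) * s ≤ 1 - Real.exp (-s) := by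
  have h := convexOn_exp.2 (Set.mem_univ 0) (Set.mem_univ (-1)) (sub_nonneg.2 h1) h0
    (sub_add_cancel 1 s)
  simp only [smul_eq_mul, mul_zero, zero_add, mul_neg, mul_one, Real.exp_zero] at h
  rw [one_div, ← Real.exp_neg]
  linarith

theorem one_sub_prod_ge {ι : Type*} (s : Finset ι) (z : ι → ℝ) (h0 : ∀ i ∈ s, 0 ≤ z i)
    (h1 : ∀ i ∈ s, z i ≤ 1) (hs : ∑ i ∈ s, z i ≤ 1) :
    (1 - 1 / Real.exp 1) * ∑ i ∈ s, z i ≤ 1 - ∏ i ∈ s, (1 - z i) := by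
  have h : ∏ i ∈ s, (1 - z i) ≤ Real.exp (-∑ i ∈ s, z i) := by
    rw [← Finset.sum_neg_distrib, Real.exp_sum]
    exact Finset.prod_le_prod (fun i hi => sub_nonneg.2 (h1 i hi))
      fun i _ => Real.one_sub_le_exp_neg _
  linarith [one_sub_exp_neg_ge (Finset.sum_nonneg h0) hs]

theorem sum_mul_mul_one_sub {ι : Type*} [Fintype ι] {w : ι → ℝ} (hw : ∑ a, w a = 1) (C : ℝ)
    (f : ι → ℝ) : ∑ a, w a * (C * (1 - f a)) = C * (1 - ∑ a, w a * f a) := by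
  have h : ∀ a, w a * (C * (1 - f a)) = C * w a - C * (w a * f a) := fun a => by ring
  rw [Finset.sum_congr rfl fun a _ => h a, Finset.sum_sub_distrib, ← Finset.mul_sum,
    ← Finset.mul_sum, hw, mul_sub]

/-! ## Running lists in parallel -/

namespace ParInstance

variable {I : ParInstance}

theorem filled_cons {r : I.Round} {h : List I.Round} {j : Fin I.k} :
    I.Filled (r :: h) j ↔ (∃ i, r j = some (i, true)) ∨ I.Filled h j := by
  simp [Filled]

theorem offered_cons {r : I.Round} {h : List I.Round} {i : Fin I.n} :
    I.Offered (r :: h) i ↔ (∃ j b, r j = some (i, b)) ∨ I.Offered h i := by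
  simp [Offered]

open Classical in
-- The rules never suppress an offer: disjoint lists exclude proposing a candidate for two
-- positions, and a list without repetitions never returns to a candidate already passed.
theorem playRound_listPolicy {L : Fin I.k → List (Fin I.n)} (hn : ∀ j, (L j).Nodup)
    (hd : ∀ j j' i, i ∈ L j → i ∈ L j' → j = j') (acc : Fin I.n → Fin I.k → Bool)
    (h : List I.Round) (hO : ∀ i, I.Offered h i → ∃ j, i ∈ (L j).take h.length) (j : Fin I.k) :
    I.playRound acc h (I.listPolicy L h) j =
      if I.Filled h j then none else ((L j)[h.length]?).map fun i => (i, acc i j) := by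
  by_cases hf : I.Filled h j
  · simp [playRound, listPolicy, hf]
  rcases ho : (L j)[h.length]? with _ | i
  · simp [playRound, listPolicy, hf, ho]
  have ha : I.listPolicy L h j = some i := by simp [listPolicy, hf, ho]
  have hmem : i ∈ L j := List.mem_of_getElem? ho
  have hno : ¬ I.Offered h i := by
    intro hoff
    obtain ⟨j', hj'⟩ := hO i hoff
    obtain rfl := hd _ _ _ hmem (List.mem_of_mem_take hj')
    obtain ⟨m, hm, hmi⟩ := List.mem_take_iff_getElem.1 hj'
    obtain ⟨hlt, he⟩ := List.getElem?_eq_some_iff.1 ho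
    have := (hn j).getElem_inj_iff.1 (hmi.trans he.symm)
    omega
  have huniq : ∀ j', I.listPolicy L h j' = some i → j' = j := by
    intro j' hj'
    by_cases hf' : I.Filled h j'
    · simp [listPolicy, hf'] at hj'
    · simp only [listPolicy, hf', if_false] at hj'
      exact hd _ _ _ (List.mem_of_getElem? hj') hmem
  rw [if_neg hf]
  simp only [playRound, ha]
  rw [if_pos ⟨hf, hno, huniq⟩]
  rfl

open Classical in
-- Invariants after `h.length` rounds: a position is filled iff someone among that many first
-- entries of its list accepts it, and only such entries have received offers. Each open position
-- then evolves on its own.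
theorem run_listPolicy {L : Fin I.k → List (Fin I.n)} (hn : ∀ j, (L j).Nodup)
    (hd : ∀ j j' i, i ∈ L j → i ∈ L j' → j = j') (acc : Fin I.n → Fin I.k → Bool) (t : ℕ)
    (h : List I.Round)
    (hF : ∀ j, I.Filled h j ↔ ∃ i ∈ (L j).take h.length, acc i j = true)
    (hO : ∀ i, I.Offered h i → ∃ j, i ∈ (L j).take h.length) :
    I.run (I.listPolicy L) acc t h = ∑ j, if I.Filled h j then 0 else
      firstValue (fun i => I.v i j) (fun i => acc i j) (((L j).drop h.length).take t) := by
  induction t generalizing h with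
  | zero => simp [run, firstValue]
  | succ t ih =>
    have hr := playRound_listPolicy hn hd acc h hO
    rw [run]
    generalize I.playRound acc h (I.listPolicy L h) = r at hr ⊢
    have htake : ∀ j i, i ∈ (L j).take (r :: h).length ↔
        i ∈ (L j).take h.length ∨ (L j)[h.length]? = some i := by
      intro j i
      rw [List.length_cons, List.take_add_one, List.mem_append]
      simp
    rw [ih (r :: h) ?_ ?_, roundReward, ← Finset.sum_add_distrib]
    · refine Finset.sum_congr rfl fun j _ => ?_
      rw [filled_cons, hr]
      by_cases hf : I.Filled h j
      · simp [hf]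
      rcases ho : (L j)[h.length]? with _ | i
      · have hlen : (L j).length ≤ h.length := List.getElem?_eq_none_iff.1 ho
        simp [hf, List.drop_eq_nil_of_le hlen,
          List.drop_eq_nil_of_le (hlen.trans (Nat.le_succ _)), firstValue]
      · obtain ⟨hlt, he⟩ := List.getElem?_eq_some_iff.1 ho
        rw [List.drop_eq_getElem_cons hlt, he, List.take_succ_cons, List.length_cons, firstValue]
        rcases hacc : acc i j <;> simp [hf, hacc]
    · intro j
      rw [filled_cons, hr]
      by_cases hf : I.Filled h j
      · obtain ⟨i, hi, hacc⟩ := (hF j).1 hf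
        exact ⟨fun _ => ⟨i, (htake j i).2 (Or.inl hi), hacc⟩, fun _ => Or.inr hf⟩
      · have hno : ∀ i ∈ (L j).take h.length, ¬ acc i j = true := fun i hi hacc =>
          hf ((hF j).2 ⟨i, hi, hacc⟩)
        rw [if_neg hf]
        simp only [htake, hf, or_false, Option.map_eq_some_iff, Prod.mk.injEq]
        constructor
        · rintro ⟨_, i, ho, rfl, hacc⟩
          exact ⟨i, Or.inr ho, hacc⟩
        · rintro ⟨i, hi | ho, hacc⟩
          · exact absurd hacc (hno i hi)
          · exact ⟨i, i, ho, rfl, hacc⟩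
    · intro i hi
      rcases offered_cons.1 hi with ⟨j, b, hj⟩ | hi
      · rw [hr] at hj
        split_ifs at hj
        simp only [Option.map_eq_some_iff, Prod.mk.injEq] at hj
        obtain ⟨i', ho, rfl, -⟩ := hj
        exact ⟨j, (htake j i').2 (Or.inr ho)⟩
      · obtain ⟨j, hj⟩ := hO i hi
        exact ⟨j, (htake j i).2 (Or.inl hj)⟩

theorem run_listPolicy_nil {L : Fin I.k → List (Fin I.n)} (hn : ∀ j, (L j).Nodup)
    (hd : ∀ j j' i, i ∈ L j → i ∈ L j' → j = j') (hT : ∀ j, (L j).length ≤ I.T)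
    (acc : Fin I.n → Fin I.k → Bool) : I.run (I.listPolicy L) acc I.T [] =
      ∑ j, firstValue (fun i => I.v i j) (fun i => acc i j) (L j) := by
  rw [run_listPolicy hn hd acc I.T [] (by simp [Filled]) (by simp [Offered])]
  refine Finset.sum_congr rfl fun j _ => ?_
  rw [if_neg (by simp [Filled]), List.length_nil, List.drop_zero, List.take_of_length_le (hT j)]

theorem AcceptanceLaw.sum_prob (D : I.AcceptanceLaw) : ∑ acc, D.prob acc = 1 := by
  have h := Fintype.prod_sum fun (i : Fin I.n) (a : Fin I.k → Bool) => (D.law i a).toReal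
  simp only [AcceptanceLaw.prob]
  rw [← h]
  simp [PMF.sum_toReal]

/-- The product involves only position `j` and has one factor per candidate. Independence across
candidates and the marginals at `j` determine its expectation, whatever the joint laws across
positions. -/
theorem AcceptanceLaw.sum_prob_mul_prod (D : I.AcceptanceLaw) (j : Fin I.k) (s : Finset (Fin I.n))
    (b : Fin I.n → ℝ) :
    ∑ acc, D.prob acc * ∏ i ∈ s, (1 - b i * (if acc i j = true then 1 else 0)) =
      ∏ i ∈ s, (1 - b i * I.p i j) := by
  have h := Fintype.prod_sum fun (i : Fin I.n) (a : Fin I.k → Bool) =>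
    (D.law i a).toReal * (if i ∈ s then 1 - b i * (if a j = true then 1 else 0) else 1)
  have hl : ∀ i, ∑ a : Fin I.k → Bool,
      (D.law i a).toReal * (if i ∈ s then 1 - b i * (if a j = true then 1 else 0) else 1) =
      if i ∈ s then 1 - b i * I.p i j else 1 := by
    intro i
    split_ifs
    · have h1 : ∀ a : Fin I.k → Bool, (D.law i a).toReal * (1 - b i * (if a j = true then 1 else 0)) =
          (D.law i a).toReal - b i * (if a j = true then (D.law i a).toReal else 0) := fun a => by
        split_ifs <;> ring
      simp only [h1, Finset.sum_sub_distrib, ← Finset.mul_sum, PMF.sum_toReal, D.marginal]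
    · simp [PMF.sum_toReal]
  simp only [hl, Finset.prod_mul_distrib, Finset.prod_ite_mem, Finset.univ_inter] at h
  exact h.symm

theorem reward_listPolicy (D : I.AcceptanceLaw) {L : Fin I.k → List (Fin I.n)}
    (hn : ∀ j, (L j).Nodup) (hd : ∀ j j' i, i ∈ L j → i ∈ L j' → j = j')
    (hT : ∀ j, (L j).length ≤ I.T) (hs : ∀ j, (L j).Pairwise fun a b => I.v b j ≤ I.v a j)
    (A : Fin I.k → Finset ℝ) (c : Fin I.k → ℝ → ℝ)
    (hv : ∀ j i, I.v i j = ∑ τ ∈ A j, c j τ * (if τ ≤ I.v i j then 1 else 0)) :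
    I.reward D (I.listPolicy L) = ∑ j, ∑ τ ∈ A j, c j τ *
      (1 - ∏ i ∈ Finset.univ.filter (fun i => τ ≤ I.v i j),
        (1 - (if i ∈ L j then 1 else 0) * I.p i j)) := by
  simp only [reward, run_listPolicy_nil hn hd hT, Finset.mul_sum]
  rw [Finset.sum_comm]
  refine Finset.sum_congr rfl fun j _ => ?_
  simp only [firstValue_eq_sum_layers _ _ (A j) (c j) (hv j) (L j) (hs j), Finset.mul_sum]
  rw [Finset.sum_comm]
  refine Finset.sum_congr rfl fun τ _ => ?_
  rw [← D.sum_prob_mul_prod j _ fun i => if i ∈ L j then 1 else 0]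
  exact sum_mul_mul_one_sub D.sum_prob _ _

/-- The algorithm collects a fraction `1 - 1 / e` of the value of the linear program. -/
theorem AlgPar.le_reward (A : I.AlgPar) (D : I.AcceptanceLaw) :
    (1 - 1 / Real.exp 1) * I.lpObjective A.y ≤ A.reward D := by
  classical
  have hy := A.optimal.1
  have hy01 : ∀ i j, 0 ≤ A.y i j ∧ A.y i j ≤ 1 := fun i j => ⟨hy.nonneg i j, hy.le_one i j⟩
  have hlayer : ∀ j, ∃ c : ℝ → ℝ, (∀ τ, 0 ≤ c τ) ∧ ∀ i, I.v i j =
      ∑ τ ∈ Finset.univ.image fun i => I.v i j, c τ * (if τ ≤ I.v i j then 1 else 0) := by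
    intro j
    obtain ⟨c, h0, -, h1⟩ := exists_layers (Finset.univ.image fun i => I.v i j) (by
      intro a ha
      obtain ⟨i, -, rfl⟩ := Finset.mem_image.1 ha
      exact I.v_nonneg i j)
    exact ⟨c, h0, fun i => h1 _ (Finset.mem_image_of_mem _ (Finset.mem_univ i))⟩
  choose c hc0 hcv using hlayer
  have hY : ∀ Y, (A.μ Y).toReal * I.reward D (I.listPolicy (A.L Y)) = (A.μ Y).toReal *
      ∑ j, ∑ τ ∈ Finset.univ.image fun i => I.v i j, c j τ *
        (1 - ∏ i ∈ Finset.univ.filter (fun i => τ ≤ I.v i j),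
          (1 - I.p i j * (if Y i j = true then 1 else 0))) := by
    intro Y
    -- Outputs of probability zero may violate the degree bounds, so the formula for the reward is
    -- claimed only with the weight of `Y` attached.
    by_cases hYμ : (A.μ Y).toReal = 0
    · rw [hYμ, zero_mul, zero_mul]
    obtain ⟨hrow, hcol⟩ := A.rounding.degree_le hy01 1 I.T (by simpa using hy.offers) hy.rounds Y hYμ
    rw [reward_listPolicy D (A.nodup Y) ?_ ?_ (A.sorted Y) _ c hcv]
    · simp only [A.mem_iff, mul_comm (I.p _ _)]
    · intro j j' i hj hj'
      have h := hrow i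
      rw [Finset.sum_boole, Nat.cast_le] at h
      exact Finset.card_le_one.1 h j (by simpa using (A.mem_iff Y j i).1 hj) j'
        (by simpa using (A.mem_iff Y j' i).1 hj')
    · intro j
      have h := hcol j
      rw [Finset.sum_boole, Nat.cast_le] at h
      rw [← List.toFinset_card_of_nodup (A.nodup Y j)]
      refine (Finset.card_le_card fun i hi => ?_).trans h
      simpa using (A.mem_iff Y j i).1 (List.mem_toFinset.1 hi)
  have hcalc : A.reward D = ∑ j, ∑ τ ∈ Finset.univ.image fun i => I.v i j, c j τ *
      (1 - ∑ Y, (A.μ Y).toReal * ∏ i ∈ Finset.univ.filter (fun i => τ ≤ I.v i j),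
          (1 - I.p i j * (if Y i j = true then 1 else 0))) := by
    rw [AlgPar.reward, Finset.sum_congr rfl fun Y _ => hY Y]
    simp only [Finset.mul_sum]
    rw [Finset.sum_comm]
    refine Finset.sum_congr rfl fun j _ => ?_
    rw [Finset.sum_comm]
    refine Finset.sum_congr rfl fun τ _ => ?_
    exact sum_mul_mul_one_sub (PMF.sum_toReal A.μ) _ _
  have hobj : I.lpObjective A.y = ∑ j, ∑ τ ∈ Finset.univ.image fun i => I.v i j, c j τ *
      ∑ i ∈ Finset.univ.filter (fun i => τ ≤ I.v i j), I.p i j * A.y i j := by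
    refine Finset.sum_congr rfl fun j _ => ?_
    rw [Finset.sum_congr rfl fun i _ => by rw [hcv j i]]
    simp only [Finset.sum_mul, Finset.mul_sum, Finset.sum_filter]
    rw [Finset.sum_comm]
    refine Finset.sum_congr rfl fun τ _ => Finset.sum_congr rfl fun i _ => ?_
    split_ifs <;> ring
  rw [hcalc, hobj]
  simp only [Finset.mul_sum (a := 1 - 1 / Real.exp 1)]
  refine Finset.sum_le_sum fun j _ => Finset.sum_le_sum fun τ _ => ?_
  rw [mul_left_comm]
  refine mul_le_mul_of_nonneg_left ?_ (hc0 j τ)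
  have hz0 : ∀ i, 0 ≤ I.p i j * A.y i j := fun i => mul_nonneg (I.p_nonneg i j) (hy.nonneg i j)
  -- The hiring constraint of position `j` bounds the sum of `p * y` over all candidates by `1`,
  -- hence also over those above the threshold.
  have hle := one_sub_prod_ge (Finset.univ.filter fun i => τ ≤ I.v i j)
    (fun i => I.p i j * A.y i j) (fun i _ => hz0 i)
    (fun i _ => mul_le_one₀ (I.p_le_one i j) (hy.nonneg i j) (hy.le_one i j))
    ((Finset.sum_le_sum_of_subset_of_nonneg (Finset.subset_univ _) fun i _ _ => hz0 i).trans
      (by simpa only [mul_comm] using hy.hires j))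
  -- Negative correlation with coefficients `p i j` bounds the failure probability of the rounded
  -- list by the product at the fractional `y`.
  have hneg := A.rounding.sum_prod_le hy01 j (Finset.univ.filter fun i => τ ≤ I.v i j)
    (fun i => I.p i j) fun i => ⟨I.p_nonneg i j, I.p_le_one i j⟩
  linarith

end ParInstance

end Hiring

theorem corollary2 (I : Hiring.ParInstance) (hI : I.IdenticalPositions) :
    I.lpValue = I.toSeq.lpValue ∧
    Nonempty I.AlgPar ∧
    ∀ (D : I.AcceptanceLaw) (A : I.AlgPar),
      (1 - 1 / Real.exp 1) * I.toSeq.opt ≤ A.reward D := by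
  refine ⟨I.lpValue_eq_lpValue_toSeq hI, I.nonempty_algPar, fun D A => ?_⟩
  have he : 0 ≤ 1 - 1 / Real.exp 1 := by
    rw [sub_nonneg, div_le_one (Real.exp_pos 1)]
    exact Real.one_le_exp zero_le_one
  refine (mul_le_mul_of_nonneg_left ?_ he).trans (A.le_reward D)
  rw [← A.optimal.lpValue_eq, I.lpValue_eq_lpValue_toSeq hI]
  exact I.toSeq.opt_le_lpValue
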